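/- Let $m,n\ge 0$. A \emph{(one-color) graph} $\Gamma$ is a finite planar graph with boundary embedded in the strip $\mathbb{R}\times[0,1]$, all of whose vertices are univalent (\emph{dots}) or trivalent, whose edges may end at the $m$ boundary points on the lower line and the $n$ boundary points on the upper line, and where edges without endpoints (circles) are allowed. Graphs are drawn in general position, i.e. as a stack of finitely many horizontal layers, each consisting of vertical strands and one elementary piece (a dot at the bottom or at the top of an edge, a trivalent vertex with two edges below or two edges above, a local minimum or a local maximum of an edge), and are considered up to planar isotopy, i.e. up to interchanging the heights of distant pieces, cancelling a minimum against a maximum of an edge, and rotating vertices. The following moves replace a subdiagram of a graph, contained in a disc, by another one (up to isotopy): \begin{itemize} \item \emph{Associativity}: one of the two planar trees with two trivalent vertices and four legs ("H" and its rotation by $90^\circ$) is replaced by the other. \item \emph{Needle}: an edge ending at a trivalent vertex whose other two ends are joined by a loop with nothing inside is replaced by an edge ending in a dot. \item \emph{Double dot removal}: a connected component consisting of an edge with dots at both ends is deleted. \item \emph{Dot contraction}: a trivalent vertex one of whose edges ends in a dot is replaced by a line, or conversely. \item \emph{Connecting}: two parallel edges with nothing between them are replaced by an "H" (two trivalent vertices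 joined by an edge, with the same four ends). \end{itemize} A \emph{simple tree} with $b$ boundary lines is: the empty graph if $b=0$; a single edge from the boundary to a dot if $b=1$; a tree with $b-2$ trivalent vertices and no dots, connecting all $b$ boundary lines, if $b\ge 2$. A \emph{simple forest} is a forest each of whose components is a simple tree. \textbf{Proposition.} Let $\Gamma$ be any one-color graph in the strip with $m$ lower and $n$ upper boundary points. \begin{enumerate} \item Using the associativity, needle, double dot removal and dot contraction moves, $\Gamma$ can be reduced to a simple forest. \item Whenever $\Gamma$ is reduced to a simple forest $F$ by these moves, all connected components of $\Gamma$ without boundary are removed, and the connectedness is otherwise unchanged: there is a bijection from the components of $F$ to the components of $\Gamma$ that contain a boundary point, which for every boundary point $x$ sends the component of $F$ containing $x$ to the component of $\Gamma$ containing $x$. \item Using the connecting move in addition, $\Gamma$ can be reduced to a single simple tree, with $m+n$ boundary lines. \end{enumerate} -/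

import Mathlib

namespace OneColor

/-- The elementary pieces of a one-color graph in the strip, read from bottom to top: a dot at the
lower or upper end of an edge, a trivalent vertex with two edges below or with two edges above,
and an edge turning at a local minimum or maximum (these last two are not vertices). -/
inductive Piece : Type
  | startDot
  | endDot
  | merge
  | split
  | cup
  | cap

/-- Number of edges entering a piece from below. -/
def Piece.dom : Piece → ℕ
  | startDot => 0
  | endDot => 1
  | merge => 2
  | split => 1
  | cup => 0
  | cap => 2

/-- Number of edges leaving a piece above. -/
def Piece.cod : Piece → ℕ
  | startDot => 1
  | endDot => 0
  | merge => 1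
  | split => 2
  | cup => 2
  | cap => 0

def Piece.IsDot (g : Piece) : Prop := g = .startDot ∨ g = .endDot

def Piece.IsTrivalent (g : Piece) : Prop := g = .merge ∨ g = .split

/-- A thin horizontal slice of the strip: one piece, with `pos` vertical strands to its left
(and any number of vertical strands to its right). -/
structure Layer : Type where
  pos : ℕ
  piece : Piece

/-- A stack of layers, listed from the bottom of the strip to the top. -/
abbrev Stack : Type := List Layer

/-- Number of strands above a layer that has `w` strands below it. -/
def Layer.next (l : Layer) (w : ℕ) : ℕ := w - l.piece.dom + l.piece.cod

/-- The stack is a picture with `m` strands at the bottom and `n` strands at the top: each layer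
finds the strands that its piece needs. -/
def Stack.Fits : ℕ → Stack → ℕ → Prop
  | m, [], n => m = n
  | m, l :: s, n => l.pos + l.piece.dom ≤ m ∧ Stack.Fits (l.next m) s n

/-- Number of strands at height `k`, that is, just above the first `k` layers. -/
def Stack.width (m : ℕ) (s : Stack) (k : ℕ) : ℕ := (s.take k).foldl (fun w l => l.next w) m

theorem Stack.width_length {m n : ℕ} {s : Stack} (h : Stack.Fits m s n) :
    Stack.width m s s.length = n := by
  induction s generalizing m with
  | nil => exact h
  | cons l s ih =>
    have := ih h.2
    simpa [Stack.width] using this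

/-- A one-color planar graph with boundary, in the strip `ℝ × [0, 1]`, with `m` boundary points on
the lower line and `n` boundary points on the upper line, drawn in general position. Dots,
trivalent vertices, edges ending on the boundary and circles are allowed. -/
structure StripGraph (m n : ℕ) : Type where
  stack : Stack
  fits : Stack.Fits m stack n

namespace StripGraph

variable {m n : ℕ}

/-! ### The underlying abstract graph, connected components, simple trees and forests -/

/-- The points of the drawing that are used to subdivide it: the `i`-th strand at height `k`, for
every `k` and `i`, and one point in the middle of every piece. -/
abbrev Vertex (Γ : StripGraph m n) : Type :=
  (Σ k : Fin (Γ.stack.length + 1), Fin (Γ.stack.width m k)) ⊕ Fin Γ.stack.length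

/-- Two of these points are joined within one layer: by a vertical strand to the left or to the
right of the piece, or by one of the legs of the piece. -/
def Link (Γ : StripGraph m n) : Γ.Vertex → Γ.Vertex → Prop
  | .inl p, .inl q => ∃ k : Fin Γ.stack.length, p.1 = k.castSucc ∧ q.1 = k.succ ∧
      (((p.2 : ℕ) < (Γ.stack.get k).pos ∧ (q.2 : ℕ) = p.2) ∨
       ((Γ.stack.get k).pos + (Γ.stack.get k).piece.dom ≤ (p.2 : ℕ) ∧
         (q.2 : ℕ) + (Γ.stack.get k).piece.dom = p.2 + (Γ.stack.get k).piece.cod))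
  | .inl p, .inr k => p.1 = k.castSucc ∧ (Γ.stack.get k).pos ≤ (p.2 : ℕ) ∧
      (p.2 : ℕ) < (Γ.stack.get k).pos + (Γ.stack.get k).piece.dom
  | .inr k, .inl q => q.1 = k.succ ∧ (Γ.stack.get k).pos ≤ (q.2 : ℕ) ∧
      (q.2 : ℕ) < (Γ.stack.get k).pos + (Γ.stack.get k).piece.cod
  | .inr _, .inr _ => False

/-- The (subdivided) abstract graph that is drawn. A circle is a cycle of this graph. -/
def toGraph (Γ : StripGraph m n) : SimpleGraph Γ.Vertex := SimpleGraph.fromRel Γ.Link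

/-- The boundary points: `m` on the lower line, `n` on the upper line. An edge that goes straight
from bottom to top in an empty stack has its two ends at the same subdivision point, but still
counts as having two boundary points. -/
def boundary (Γ : StripGraph m n) : Fin m ⊕ Fin n → Γ.Vertex
  | .inl i => .inl ⟨⟨0, Nat.succ_pos _⟩, i⟩
  | .inr j => .inl ⟨⟨Γ.stack.length, Nat.lt_succ_self _⟩, Fin.cast (Stack.width_length Γ.fits).symm j⟩

abbrev Component (Γ : StripGraph m n) : Type := Γ.toGraph.ConnectedComponent

/-- The component that contains a given boundary point. -/
def componentAt (Γ : StripGraph m n) (x : Fin m ⊕ Fin n) : Γ.Component :=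
  Γ.toGraph.connectedComponentMk (Γ.boundary x)

/-- Number of boundary lines of a component. -/
noncomputable def numBoundary (Γ : StripGraph m n) (C : Γ.Component) : ℕ :=
  Nat.card {x : Fin m ⊕ Fin n // Γ.componentAt x = C}

/-- Number of trivalent vertices of a component. -/
noncomputable def numTrivalent (Γ : StripGraph m n) (C : Γ.Component) : ℕ :=
  Nat.card {k : Fin Γ.stack.length //
    (Γ.stack.get k).piece.IsTrivalent ∧ Γ.toGraph.connectedComponentMk (.inr k) = C}

/-- Number of dots of a component. -/
noncomputable def numDots (Γ : StripGraph m n) (C : Γ.Component) : ℕ :=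
  Nat.card {k : Fin Γ.stack.length //
    (Γ.stack.get k).piece.IsDot ∧ Γ.toGraph.connectedComponentMk (.inr k) = C}

/-- A component is a (nonempty) simple tree: it is a tree, and if it has `b ≥ 2` boundary lines,
then its vertices are `b - 2` trivalent vertices, while if `b = 1`, it is one edge from the boundary
to a dot. (The simple tree with `b = 0` is empty, hence never a component.) -/
def IsSimpleTreeComponent (Γ : StripGraph m n) (C : Γ.Component) : Prop :=
  C.toSimpleGraph.IsTree ∧
    ((2 ≤ Γ.numBoundary C ∧ Γ.numTrivalent C + 2 = Γ.numBoundary C ∧ Γ.numDots C = 0) ∨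
     (Γ.numBoundary C = 1 ∧ Γ.numTrivalent C = 0 ∧ Γ.numDots C = 1))

/-- Every component is a simple tree. -/
def IsSimpleForest (Γ : StripGraph m n) : Prop := ∀ C : Γ.Component, Γ.IsSimpleTreeComponent C

/-- The whole graph is a simple tree: it is the empty graph if there is no boundary, and otherwise it
is connected and its only component is a simple tree. -/
def IsSimpleTree (Γ : StripGraph m n) : Prop :=
  (m + n = 0 ∧ IsEmpty Γ.Vertex) ∨
    (Γ.toGraph.Connected ∧ ∀ C : Γ.Component, Γ.IsSimpleTreeComponent C)

end StripGraph

/-! ### Isotopy and reduction moves -/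

/-- Put a local picture `a` strands further to the right. -/
def Stack.shift (a : ℕ) (s : Stack) : Stack := s.map fun l => ⟨a + l.pos, l.piece⟩

/-- `Γ'` is obtained from `Γ` by replacing a subdiagram `X` by a subdiagram `Y` with `R X Y`. The
subdiagram occupies consecutive layers and has `a` strands on its left, and any number on its
right. -/
def LocalStep {m n : ℕ} (R : Stack → Stack → Prop) (Γ Γ' : StripGraph m n) : Prop :=
  ∃ (lower upper X Y : Stack) (a : ℕ), R X Y ∧
    Γ.stack = lower ++ Stack.shift a X ++ upper ∧ Γ'.stack = lower ++ Stack.shift a Y ++ upper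

open Piece in
/-- The elementary planar isotopies between graphs in general position (used in both directions). -/
inductive IsotopyRule : Stack → Stack → Prop
  /-- Two pieces, the second one `k` strands to the right of the first, change heights. -/
  | exchange (g h : Piece) (k : ℕ) :
      IsotopyRule [⟨0, g⟩, ⟨g.cod + k, h⟩] [⟨g.dom + k, h⟩, ⟨0, g⟩]
  /-- A minimum and a maximum on one edge cancel. -/
  | zigzagLeft : IsotopyRule [⟨1, cup⟩, ⟨0, cap⟩] []
  | zigzagRight : IsotopyRule [⟨0, cup⟩, ⟨1, cap⟩] []
  /-- Rotation of a trivalent vertex. -/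
  | twistSplitRight : IsotopyRule [⟨0, split⟩, ⟨1, cap⟩] [⟨0, merge⟩]
  | twistSplitLeft : IsotopyRule [⟨1, split⟩, ⟨0, cap⟩] [⟨0, merge⟩]
  | twistMergeLeft : IsotopyRule [⟨0, cup⟩, ⟨1, merge⟩] [⟨0, split⟩]
  | twistMergeRight : IsotopyRule [⟨1, cup⟩, ⟨0, merge⟩] [⟨0, split⟩]
  /-- Rotation of a dot. -/
  | twistStartLeft : IsotopyRule [⟨0, startDot⟩, ⟨0, cap⟩] [⟨0, endDot⟩]
  | twistStartRight : IsotopyRule [⟨1, startDot⟩, ⟨0, cap⟩] [⟨0, endDot⟩]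
  | twistEndLeft : IsotopyRule [⟨0, cup⟩, ⟨0, endDot⟩] [⟨0, startDot⟩]
  | twistEndRight : IsotopyRule [⟨0, cup⟩, ⟨1, endDot⟩] [⟨0, startDot⟩]

open Piece in
/-- The associativity, needle, double dot removal and dot contraction moves. Each is given in one
position; its rotations are the same move up to isotopy. -/
inductive BasicMove : Stack → Stack → Prop
  /-- The two trivalent trees with four legs: middle edge vertical, respectively horizontal. -/
  | assoc : BasicMove [⟨0, merge⟩, ⟨0, split⟩] [⟨0, split⟩, ⟨1, merge⟩]
  | assocRotated : BasicMove [⟨0, split⟩, ⟨1, merge⟩] [⟨0, merge⟩, ⟨0, split⟩]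
  /-- A loop with nothing inside, on a stem, becomes a dot on the stem. -/
  | needle : BasicMove [⟨0, split⟩, ⟨0, cap⟩] [⟨0, endDot⟩]
  /-- A component that is an edge with a dot at both ends is deleted. -/
  | doubleDotRemoval : BasicMove [⟨0, startDot⟩, ⟨0, endDot⟩] []
  /-- A trivalent vertex with a dot on one of its edges becomes a line, and conversely. -/
  | dotContraction : BasicMove [⟨0, merge⟩, ⟨0, endDot⟩] [⟨0, cap⟩]
  | dotExpansion : BasicMove [⟨0, cap⟩] [⟨0, merge⟩, ⟨0, endDot⟩]

open Piece in
/-- The basic moves and the connecting move: two parallel edges with nothing between them become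
two trivalent vertices joined by an edge. -/
inductive ConnectingOrBasicMove : Stack → Stack → Prop
  | basic {X Y : Stack} : BasicMove X Y → ConnectingOrBasicMove X Y
  | connecting : ConnectingOrBasicMove [] [⟨0, merge⟩, ⟨0, split⟩]

/-- `Γ` can be turned into `Γ'` by finitely many moves from `R` and planar isotopies. -/
def Reduces {m n : ℕ} (R : Stack → Stack → Prop) : StripGraph m n → StripGraph m n → Prop :=
  Relation.ReflTransGen fun Γ Γ' =>
    LocalStep IsotopyRule Γ Γ' ∨ LocalStep IsotopyRule Γ' Γ ∨ LocalStep R Γ Γ'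

end OneColor

/-!
The moves act like the relations of a special Frobenius algebra in a planar (non-symmetric) monoidal
category: merges and splits are multiplication and comultiplication, dots are unit and counit, and
the moves imply the unit and counit laws, both Frobenius relations and `red_bubble` (a digon on a
strand disappears).

*Reduction to a forest.* Call merges, upper dots and maxima lower pieces, and splits, lower dots and
minima upper pieces. A lower piece that lies above an upper piece can be moved below it: if they
share no strand their heights are exchanged, and otherwise one local relation replaces the pair by
at most one lower piece with at most one upper piece above it (`swap_lower_upper`). So every stack
can be sorted into lower pieces followed by upper pieces, as in an epi-mono factorization
(`exists_red_lower_upper`). Sorting each half once more brings all dots next to the boundary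
(`exists_red_forest`). In such a stack every point has at most one neighbour that is closer to the
waist, the height where the two halves meet. Hence the graph is a forest whose components correspond
to the points without such a neighbour (`Waist.isAcyclic`, `Waist.card_roots`). Counting strands
layer by layer from the waist then yields, for each component,
trivalent vertices + 2 = boundary points + dots (`Waist.numTrivalent_add_two`), and a component with
a dot is a single edge (`isSimpleForest_of_stack`).

*Connectedness.* Two boundary points lie in the same component exactly when every colouring of the
strands that is constant along edges gives them the same colour (`componentAt_eq_iff`). Colourings
are relations between colour lists that compose along stacks, so their invariance is checked on the
two sides of each rule. As every component of a simple forest meets the boundary, this invariance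
gives the bijection of components (`Reduces.exists_component_equiv`).

*Reduction to a tree.* The connecting move turns a dot or an extremum with a strand beside it into
merges or splits. What remains are merges followed by splits, with a dot or an extremum only where
the strip has no strands at all on one side; parallel strands at the waist are then connected
(`exists_redAt_treeStack`). Such a stack has exactly one root, so it is connected.
-/

namespace OneColor

/-! ### Forests given by a parent relation -/

section ParentForest
variable {V : Type*} {G : SimpleGraph V} {Par : V → V → Prop} {rank : V → ℕ}

/-- If every vertex has at most one neighbour of smaller rank, and adjacent vertices have different
ranks, then there is no cycle: a vertex of maximal rank on it would have two smaller neighbours. -/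
theorem isAcyclic_of_parent (hadj : ∀ v w, G.Adj v w → Par v w ∨ Par w v)
    (hrank : ∀ v w, Par v w → rank w < rank v)
    (hfun : ∀ v w w', Par v w → Par v w' → w = w') : G.IsAcyclic := by
  classical
  intro v c hc
  obtain ⟨u, hu, hmax⟩ := c.support.toFinset.exists_max_image rank
    ⟨v, by simp⟩
  simp only [List.mem_toFinset] at hu hmax
  have hc' := hc.rotate hu
  have key : ∀ w, w ∈ (c.rotate u hu).support → G.Adj u w → Par u w := by
    intro w hw ha
    rcases hadj _ _ ha with h | h
    · exact h
    · have h1 := hrank _ _ h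
      have h2 := hmax w ((c.mem_support_rotate_iff u hu).1 hw)
      omega
  have h1 := key _ ((c.rotate u hu).getVert_mem_support 1) ((c.rotate u hu).adj_snd hc'.not_nil)
  have h2 := key _ ((c.rotate u hu).getVert_mem_support _)
    ((c.rotate u hu).adj_penultimate hc'.not_nil).symm
  exact hc'.snd_ne_penultimate (hfun _ _ _ h1 h2)

/-- In the component of a root, every path of parents leads to the root. -/
theorem reflTransGen_parent_of_reachable (hadj : ∀ v w, G.Adj v w → Par v w ∨ Par w v)
    (hfun : ∀ v w w', Par v w → Par v w' → w = w') {r v : V} (hr : ∀ w, ¬ Par r w)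
    (h : G.Reachable r v) : Relation.ReflTransGen Par v r := by
  rw [SimpleGraph.reachable_iff_reflTransGen] at h
  induction h with
  | refl => exact .refl
  | tail _ hab ih =>
    rcases hadj _ _ hab with h | h
    · rcases Relation.ReflTransGen.cases_head ih with rfl | ⟨d, hd, hd'⟩
      · exact absurd h (hr _)
      · rwa [hfun _ _ _ h hd]
    · exact .head h ih

theorem root_unique (hadj : ∀ v w, G.Adj v w → Par v w ∨ Par w v)
    (hfun : ∀ v w w', Par v w → Par v w' → w = w') {r v : V} (hr : ∀ w, ¬ Par r w)
    (hv : ∀ w, ¬ Par v w) (h : G.Reachable r v) : v = r := by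
  rcases (reflTransGen_parent_of_reachable hadj hfun hr h).cases_head with h | ⟨d, hd, -⟩
  · exact h
  · exact absurd hd (hv d)

theorem exists_root_reachable (hpar : ∀ v w, Par v w → G.Adj v w)
    (hrank : ∀ v w, Par v w → rank w < rank v) (v : V) :
    ∃ r, (∀ w, ¬ Par r w) ∧ G.Reachable v r := by
  induction h : rank v using Nat.strong_induction_on generalizing v with
  | _ k ih =>
    by_cases hv : ∀ w, ¬ Par v w
    · exact ⟨v, hv, .refl _⟩
    · push Not at hv
      obtain ⟨w, hw⟩ := hv
      obtain ⟨r, hr, hwr⟩ := ih _ (h ▸ hrank _ _ hw) w rfl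
      exact ⟨r, hr, (hpar _ _ hw).reachable.trans hwr⟩

end ParentForest

/-! ### Stacks of layers and their colourings -/

theorem Stack.width_succ (m : ℕ) (s : Stack) (k : ℕ) (hk : k < s.length) :
    Stack.width m s (k + 1) = s[k].next (Stack.width m s k) := by
  rw [Stack.width, ← List.take_append_getElem hk, List.foldl_append]
  rfl

theorem Stack.width_zero (m : ℕ) (s : Stack) : Stack.width m s 0 = m := rfl

theorem Stack.fits_append {m n : ℕ} {s t : Stack} :
    Stack.Fits m (s ++ t) n ↔ ∃ k, Stack.Fits m s k ∧ Stack.Fits k t n := by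
  induction s generalizing m with
  | nil => simp [Stack.Fits]
  | cons l s ih => simp [Stack.Fits, ih, and_assoc]

theorem Stack.Fits.get {m n : ℕ} {s : Stack} (h : Stack.Fits m s n) (k : ℕ) (hk : k < s.length) :
    s[k].pos + s[k].piece.dom ≤ Stack.width m s k := by
  induction s generalizing m k with
  | nil => simp at hk
  | cons l s ih =>
    cases k with
    | zero => exact h.1
    | succ k => simpa [Stack.width] using ih h.2 k (by simpa using hk)

/-- A layer relates the colours of the strands below it to those of the strands above it: all legs
of its piece have the same colour `a`, and the other strands keep theirs. -/
def Layer.Colors {α : Type*} (l : Layer) (c c' : List α) : Prop :=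
  ∃ (u v : List α) (a : α), u.length = l.pos ∧ c = u ++ List.replicate l.piece.dom a ++ v ∧
    c' = u ++ List.replicate l.piece.cod a ++ v

/-- The lists of colours on the lower and on the upper line that extend to a colouring of the whole
stack: the composite of the relations given by the layers. -/
def Stack.Colors {α : Type*} : List α → Stack → List α → Prop
  | c, [], c' => c = c'
  | c, l :: s, c' => ∃ d, l.Colors c d ∧ Stack.Colors d s c'

section Colors
variable {α : Type*}

theorem Stack.colors_append {c c' : List α} {s t : Stack} :
    Stack.Colors c (s ++ t) c' ↔ ∃ d, Stack.Colors c s d ∧ Stack.Colors d t c' := by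
  induction s generalizing c with
  | nil => simp [Stack.Colors]
  | cons l s ih =>
    simp only [List.cons_append, Stack.Colors, ih]
    constructor
    · rintro ⟨d, h, e, h1, h2⟩; exact ⟨e, ⟨d, h, h1⟩, h2⟩
    · rintro ⟨e, ⟨d, h, h1⟩, h2⟩; exact ⟨d, h, e, h1, h2⟩

theorem Layer.Colors.shift {l : Layer} {c c' : List α} (a : ℕ) :
    (⟨a + l.pos, l.piece⟩ : Layer).Colors c c' ↔
      ∃ w d d', w.length = a ∧ c = w ++ d ∧ c' = w ++ d' ∧ l.Colors d d' := by
  constructor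
  · rintro ⟨u, v, x, hu, rfl, rfl⟩
    refine ⟨u.take a, u.drop a ++ List.replicate l.piece.dom x ++ v,
      u.drop a ++ List.replicate l.piece.cod x ++ v, ?_, ?_, ?_,
      u.drop a, v, x, ?_, rfl, rfl⟩
    · simp only [List.length_take]; simp only at hu; omega
    · simp [← List.append_assoc]
    · simp [← List.append_assoc]
    · simp only [List.length_drop]; simp only at hu; omega
  · rintro ⟨w, d, d', hw, rfl, rfl, u, v, x, hu, rfl, rfl⟩
    exact ⟨w ++ u, v, x, by simp [hw, hu], by simp, by simp⟩

theorem Stack.colors_shift {a : ℕ} {s : Stack} {c c' : List α} (ha : a ≤ c.length) :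
    Stack.Colors c (Stack.shift a s) c' ↔
      ∃ w d d', w.length = a ∧ c = w ++ d ∧ c' = w ++ d' ∧ Stack.Colors d s d' := by
  induction s generalizing c with
  | nil =>
    simp only [Stack.shift, List.map_nil, Stack.Colors]
    constructor
    · rintro rfl
      exact ⟨c.take a, c.drop a, c.drop a, by simpa using ha, by simp, by simp, rfl⟩
    · rintro ⟨w, d, d', -, rfl, rfl, rfl⟩; rfl
  | cons l s ih =>
    simp only [Stack.shift, List.map_cons, Stack.Colors]
    constructor
    · rintro ⟨e, h, h'⟩
      obtain ⟨w, d, d', hw, rfl, rfl, hd⟩ := (Layer.Colors.shift a).1 h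
      obtain ⟨w', x, x', hw', h1, rfl, hx⟩ := (ih (by simp [hw])).1 h'
      obtain ⟨rfl, rfl⟩ := List.append_inj h1 (by omega)
      exact ⟨w, d, x', hw, rfl, rfl, d', hd, hx⟩
    · rintro ⟨w, d, d', hw, rfl, rfl, e, h1, h2⟩
      exact ⟨w ++ e, (Layer.Colors.shift a).2 ⟨w, d, e, hw, rfl, rfl, h1⟩,
        (ih (by simp [hw])).2 ⟨w, e, d', hw, rfl, rfl, h2⟩⟩

theorem Layer.Colors.length {l : Layer} {c c' : List α} (h : l.Colors c c') :
    l.pos + l.piece.dom ≤ c.length ∧ c'.length = l.next c.length := by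
  obtain ⟨u, v, a, hu, rfl, rfl⟩ := h
  simp [Layer.next, hu]; omega

theorem Stack.Colors.length {m n : ℕ} {s : Stack} {c c' : List α} (h : Stack.Colors c s c')
    (hs : Stack.Fits m s n) (hc : c.length = m) : c'.length = n := by
  induction s generalizing c m with
  | nil => obtain rfl : c = c' := h; exact hc.trans hs
  | cons l s ih =>
    obtain ⟨d, h1, h2⟩ := h
    exact ih h2 hs.2 (by rw [h1.length.2, hc])

/-- A colouring of a stack, as the sequence of the colourings of its horizontal cross-sections. -/
theorem Stack.colors_iff_seq {s : Stack} {c c' : List α} :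
    Stack.Colors c s c' ↔ ∃ γ : ℕ → List α, γ 0 = c ∧ γ s.length = c' ∧
      ∀ k (hk : k < s.length), s[k].Colors (γ k) (γ (k + 1)) := by
  induction s generalizing c with
  | nil =>
    constructor
    · rintro h; exact ⟨fun _ => c, rfl, h, by simp⟩
    · rintro ⟨γ, rfl, h, -⟩; exact h
  | cons l s ih =>
    constructor
    · rintro ⟨d, h1, h2⟩
      obtain ⟨γ, h3, h4, h5⟩ := ih.1 h2
      refine ⟨fun k => k.casesOn c γ, rfl, h4, ?_⟩
      rintro (_ | k) hk
      · simpa [h3] using h1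
      · exact h5 k (by simpa using hk)
    · rintro ⟨γ, rfl, h4, h5⟩
      exact ⟨γ 1, h5 0 (by simp), ih.2 ⟨fun k => γ (k + 1), rfl, h4,
        fun k hk => h5 (k + 1) (by simpa using hk)⟩⟩

/-- Two local pictures that admit the same colours on their boundary, wherever both of them fit.
Without the condition that they fit, the two sides of the zigzag rules would differ. -/
def SameColors (α : Type*) (X Y : Stack) : Prop :=
  ∀ c c' : List α, (∃ n, Stack.Fits c.length X n) → (∃ n, Stack.Fits c.length Y n) →
    (Stack.Colors c X c' ↔ Stack.Colors c Y c')

end Colors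

theorem sameColors_exchange (α : Type*) (g h : Piece) (k : ℕ) :
    SameColors α [⟨0, g⟩, ⟨g.cod + k, h⟩] [⟨g.dom + k, h⟩, ⟨0, g⟩] := by
  intro c c' _ _
  simp only [Stack.Colors, Layer.Colors]
  constructor
  · rintro ⟨d, ⟨u, v, a, hu, rfl, rfl⟩, d', ⟨u', v', a', hu', h1, rfl⟩, rfl⟩
    obtain rfl := List.length_eq_zero_iff.1 hu
    simp only [List.nil_append, List.append_assoc] at h1 ⊢
    rcases List.append_eq_append_iff.1 h1 with ⟨x, rfl, rfl⟩ | ⟨x, hx, hx'⟩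
    · have hx : x.length = k := by simpa using hu'
      exact ⟨List.replicate g.dom a ++ x ++ List.replicate h.cod a' ++ v',
        ⟨List.replicate g.dom a ++ x, v', a', by simp [hx], by simp, by simp⟩, _,
        ⟨[], x ++ List.replicate h.cod a' ++ v', a, rfl, by simp, rfl⟩, by simp⟩
    · have hl := congrArg List.length hx
      simp only [List.length_append, List.length_replicate] at hl
      obtain rfl : x = [] := List.length_eq_zero_iff.1 (by omega)
      obtain rfl : k = 0 := by simp at hl; omega
      simp only [List.append_nil] at hx
      subst hx
      simp only [List.nil_append] at hx'
      subst hx'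
      exact ⟨List.replicate g.dom a ++ List.replicate h.cod a' ++ v',
        ⟨List.replicate g.dom a, v', a', by simp, by simp, by simp⟩, _,
        ⟨[], List.replicate h.cod a' ++ v', a, rfl, by simp, rfl⟩, by simp⟩
  · rintro ⟨d, ⟨u, v, a, hu, rfl, rfl⟩, d', ⟨u', v', a', hu', h1, rfl⟩, rfl⟩
    obtain rfl := List.length_eq_zero_iff.1 hu'
    simp only [List.nil_append, List.append_assoc] at h1 ⊢
    rcases List.append_eq_append_iff.1 h1 with ⟨x, hx, hx'⟩ | ⟨x, rfl, rfl⟩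
    · have hl := congrArg List.length hx
      simp only [List.length_append, List.length_replicate] at hl
      obtain rfl : x = [] := List.length_eq_zero_iff.1 (by omega)
      obtain rfl : k = 0 := by simp at hl; omega
      simp only [List.append_nil] at hx
      subst hx
      simp only [List.nil_append] at hx'
      subst hx'
      exact ⟨List.replicate g.cod a' ++ List.replicate h.dom a ++ v,
        ⟨[], List.replicate h.dom a ++ v, a', rfl, by simp, by simp⟩, _,
        ⟨List.replicate g.cod a', v, a, by simp, by simp, rfl⟩, by simp⟩
    · have hx : x.length = k := by simpa using hu
      exact ⟨List.replicate g.cod a' ++ x ++ List.replicate h.dom a ++ v,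
        ⟨[], x ++ List.replicate h.dom a ++ v, a', rfl, by simp, by simp⟩, _,
        ⟨List.replicate g.cod a' ++ x, v, a, by simp [hx], by simp, rfl⟩, by simp⟩

theorem layer0_colors {α : Type*} (g : Piece) (c c' : List α) : (⟨0, g⟩ : Layer).Colors c c' ↔
    ∃ v a, c = List.replicate g.dom a ++ v ∧ c' = List.replicate g.cod a ++ v := by
  constructor
  · rintro ⟨u, v, a, hu, rfl, rfl⟩
    obtain rfl := List.length_eq_zero_iff.1 hu
    exact ⟨v, a, rfl, rfl⟩
  · rintro ⟨v, a, rfl, rfl⟩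
    exact ⟨[], v, a, rfl, rfl, rfl⟩

theorem layer1_colors {α : Type*} (g : Piece) (c c' : List α) : (⟨1, g⟩ : Layer).Colors c c' ↔
    ∃ b v a, c = b :: (List.replicate g.dom a ++ v) ∧ c' = b :: (List.replicate g.cod a ++ v) := by
  constructor
  · rintro ⟨u, v, a, hu, rfl, rfl⟩
    obtain ⟨b, rfl⟩ := List.length_eq_one_iff.1 hu
    exact ⟨b, v, a, rfl, rfl⟩
  · rintro ⟨b, v, a, rfl, rfl⟩
    exact ⟨[b], v, a, rfl, rfl, rfl⟩

theorem IsotopyRule.sameColors (α : Type*) [Nonempty α] {X Y : Stack} (h : IsotopyRule X Y) :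
    SameColors α X Y := by
  cases h with
  | exchange g h k => exact sameColors_exchange α g h k
  | _ =>
    rintro c c' ⟨n, hX⟩ ⟨n', hY⟩
    simp only [Stack.Fits, Piece.dom, Layer.next, Piece.cod] at hX hY
    simp only [Stack.Colors, layer0_colors, layer1_colors, Piece.dom, Piece.cod,
      List.replicate]
    rcases c with _ | ⟨x, _ | ⟨y, c⟩⟩ <;> simp at hX hY ⊢ <;> grind

/-- The colour type must not be empty: a component that is deleted has some colour. -/
theorem BasicMove.sameColors (α : Type*) [Nonempty α] {X Y : Stack} (h : BasicMove X Y) :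
    SameColors α X Y := by
  cases h with
  | _ =>
    rintro c c' ⟨n, hX⟩ ⟨n', hY⟩
    simp only [Stack.Fits, Piece.dom, Layer.next, Piece.cod] at hX hY
    simp only [Stack.Colors, layer0_colors, layer1_colors, Piece.dom, Piece.cod,
      List.replicate]
    rcases c with _ | ⟨x, _ | ⟨y, c⟩⟩ <;> simp at hX hY ⊢

theorem Stack.fits_shift {a w n' : ℕ} {s : Stack} :
    Stack.Fits (a + w) (Stack.shift a s) n' ↔ ∃ n, n' = a + n ∧ Stack.Fits w s n := by
  induction s generalizing w with
  | nil =>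
    simp only [Stack.shift, List.map_nil, Stack.Fits]
    constructor
    · rintro rfl; exact ⟨w, rfl, rfl⟩
    · rintro ⟨n, rfl, rfl⟩; rfl
  | cons l s ih =>
    simp only [Stack.shift, List.map_cons, Stack.Fits]
    have key : l.pos + l.piece.dom ≤ w →
        Layer.next ⟨a + l.pos, l.piece⟩ (a + w) = a + l.next w := by
      intro h; simp only [Layer.next]; omega
    constructor
    · rintro ⟨h, h'⟩
      rw [key (by omega)] at h'
      obtain ⟨n, rfl, hn⟩ := ih.1 h'
      exact ⟨n, rfl, by omega, hn⟩
    · rintro ⟨n, rfl, h, h'⟩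
      refine ⟨by omega, ?_⟩
      rw [key h]
      exact ih.2 ⟨n, rfl, h'⟩

theorem Stack.eq_nil_of_fits_shift {a k n : ℕ} {s : Stack}
    (h : Stack.Fits k (Stack.shift a s) n) (hk : k < a) : s = [] := by
  cases s with
  | nil => rfl
  | cons l s =>
    have := h.1
    simp only at this
    omega

/-- Moves that preserve the colourings of a local picture preserve those of the whole picture. -/
theorem LocalStep.colors_iff {α : Type*} {m n : ℕ} {R : Stack → Stack → Prop}
    (hR : ∀ X Y, R X Y → SameColors α X Y) {Γ Γ' : StripGraph m n} (h : LocalStep R Γ Γ')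
    (c c' : List α) (hc : c.length = m) :
    Stack.Colors c Γ.stack c' ↔ Stack.Colors c Γ'.stack c' := by
  obtain ⟨lower, upper, X, Y, a, hXY, h1, h2⟩ := h
  have f1 := Γ.fits
  have f2 := Γ'.fits
  rw [h1, Stack.fits_append] at f1
  rw [h2, Stack.fits_append] at f2
  obtain ⟨_, f1, -⟩ := f1
  obtain ⟨_, f2, -⟩ := f2
  obtain ⟨k, hk, f1⟩ := Stack.fits_append.1 f1
  obtain ⟨k', hk', f2⟩ := Stack.fits_append.1 f2
  simp only [h1, h2, Stack.colors_append]
  refine exists_congr fun d' => and_congr_left fun _ => exists_congr fun d =>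
    and_congr_right fun hd => ?_
  obtain rfl := hd.length hk hc
  obtain rfl := hd.length hk' hc
  rcases lt_or_ge d.length a with hlt | hle
  · rw [Stack.eq_nil_of_fits_shift f1 hlt, Stack.eq_nil_of_fits_shift f2 hlt]
  · rw [Stack.colors_shift hle, Stack.colors_shift hle]
    refine exists_congr fun w => exists_congr fun e => exists_congr fun e' =>
      and_congr_right fun hw => and_congr_right fun he => and_congr_right fun _ => ?_
    have hl : d.length = a + e.length := by rw [he, List.length_append, hw]
    rw [hl] at f1 f2
    obtain ⟨n1, -, f1⟩ := Stack.fits_shift.1 f1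
    obtain ⟨n2, -, f2⟩ := Stack.fits_shift.1 f2
    exact hR X Y hXY e e' ⟨_, f1⟩ ⟨_, f2⟩

theorem Reduces.colors_iff {α : Type*} [Nonempty α] {m n : ℕ} {Γ F : StripGraph m n}
    (h : Reduces BasicMove Γ F) (c c' : List α) (hc : c.length = m) :
    Stack.Colors c Γ.stack c' ↔ Stack.Colors c F.stack c' := by
  induction h with
  | refl => rfl
  | tail _ hab ih =>
    rw [ih]
    rcases hab with h | h | h
    · exact h.colors_iff (fun X Y h => h.sameColors α) c c' hc
    · exact (h.colors_iff (fun X Y h => h.sameColors α) c c' hc).symm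
    · exact h.colors_iff (fun X Y h => h.sameColors α) c c' hc

/-! ### Colourings and connected components -/

namespace StripGraph
variable {m n : ℕ} (Γ : StripGraph m n)

section
variable {α : Type*}

/-- The colours of the strands at height `k`. -/
def crossSection (f : Γ.Vertex → α) (k : Fin (Γ.stack.length + 1)) : List α :=
  List.ofFn fun i => f (.inl ⟨k, i⟩)

variable {Γ}

/-- A function on the points of the drawing that is constant along links induces colours of the
cross-sections that are compatible with every layer. -/
theorem crossSection_succ {f : Γ.Vertex → α} (hf : ∀ v w, Γ.Link v w → f v = f w)
    (k : Fin Γ.stack.length) :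
    ∃ u v : List α, u.length = (Γ.stack.get k).pos ∧
      Γ.crossSection f k.castSucc =
        u ++ List.replicate (Γ.stack.get k).piece.dom (f (.inr k)) ++ v ∧
      Γ.crossSection f k.succ =
        u ++ List.replicate (Γ.stack.get k).piece.cod (f (.inr k)) ++ v := by
  have hfit := Γ.fits.get k k.2
  have hw : Γ.stack.width m (k + 1) = _ := Stack.width_succ m Γ.stack k k.2
  have hget : Γ.stack.get k = Γ.stack[(k : ℕ)] := rfl
  rw [← hget] at hfit hw
  obtain ⟨l, hl⟩ : ∃ l, l = Γ.stack.get k := ⟨_, rfl⟩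
  have e1 : (Γ.stack.get k).pos = l.pos := by rw [hl]
  have e2 : (Γ.stack.get k).piece.dom = l.piece.dom := by rw [hl]
  have e3 : (Γ.stack.get k).piece.cod = l.piece.cod := by rw [hl]
  rw [← hl] at hfit hw ⊢
  simp only [Layer.next] at hw
  have len1 : (Γ.crossSection f k.castSucc).length = Γ.stack.width m k := by simp [crossSection]
  have len2 : (Γ.crossSection f k.succ).length = Γ.stack.width m (k + 1) := by simp [crossSection]
  refine ⟨(Γ.crossSection f k.castSucc).take l.pos,
    (Γ.crossSection f k.castSucc).drop (l.pos + l.piece.dom), ?_, ?_, ?_⟩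
  · rw [List.length_take, len1]; omega
  · apply List.ext_getElem
    · simp only [List.length_append, List.length_take, List.length_drop, List.length_replicate,
        len1]
      omega
    · intro i h1 h2
      simp only [List.getElem_append, List.length_append, List.length_take, len1,
        List.length_replicate, List.getElem_take, List.getElem_replicate, List.getElem_drop]
      have h3 : i < Γ.stack.width m k := by omega
      split_ifs with h4 h5
      · rfl
      · simp only [crossSection, List.getElem_ofFn]
        exact hf _ _ ⟨rfl, by simp only; omega, by simp only; omega⟩
      · congr 1; omega
  · apply List.ext_getElem
    · simp only [List.length_append, List.length_take, List.length_drop, List.length_replicate,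
        len1, len2]
      omega
    · intro i h1 h2
      simp only [List.getElem_append, List.length_append, List.length_take, len1,
        List.length_replicate, List.getElem_take, List.getElem_replicate, List.getElem_drop]
      have h3 : i < Γ.stack.width m (k + 1) := by omega
      split_ifs with h4 h5
      · simp only [crossSection, List.getElem_ofFn]
        exact (hf (.inl ⟨k.castSucc, ⟨i, _⟩⟩) (.inl ⟨k.succ, ⟨i, _⟩⟩)
          ⟨k, rfl, rfl, .inl ⟨by simp only; omega, rfl⟩⟩).symm
      · simp only [crossSection, List.getElem_ofFn]
        exact (hf (.inr k) (.inl ⟨k.succ, ⟨i, _⟩⟩)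
          ⟨rfl, by simp only; omega, by simp only; omega⟩).symm
      · simp only [crossSection, List.getElem_ofFn]
        exact (hf (.inl ⟨k.castSucc, ⟨_, _⟩⟩) (.inl ⟨k.succ, ⟨i, _⟩⟩)
          ⟨k, rfl, rfl, .inr ⟨by simp only; omega, by simp only; omega⟩⟩).symm

theorem colors_crossSection {f : Γ.Vertex → α} (hf : ∀ v w, Γ.Link v w → f v = f w) :
    Stack.Colors (Γ.crossSection f 0) Γ.stack (Γ.crossSection f (Fin.last _)) := by
  refine Stack.colors_iff_seq.2 ⟨fun k => if h : k < Γ.stack.length + 1 then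
    Γ.crossSection f ⟨k, h⟩ else [], ?_, ?_, ?_⟩
  · simp
  · simp [Fin.last]
  · intro k hk
    obtain ⟨u, v, h1, h2, h3⟩ := crossSection_succ hf ⟨k, hk⟩
    refine ⟨u, v, f (.inr ⟨k, hk⟩), h1, ?_, ?_⟩
    · beta_reduce; rw [dif_pos (by omega)]; exact h2
    · beta_reduce; rw [dif_pos (by omega)]; exact h3

/-- Conversely, compatible colours of the boundary extend to all points of the drawing. -/
theorem exists_coloring {c c' : List α} (h : Stack.Colors c Γ.stack c') (hc : c.length = m) :
    ∃ f : Γ.Vertex → α, (∀ v w, Γ.Link v w → f v = f w) ∧ Γ.crossSection f 0 = c ∧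
      Γ.crossSection f (Fin.last _) = c' := by
  obtain ⟨γ, h0, hl, hγ⟩ := Stack.colors_iff_seq.1 h
  have hlen : ∀ k, k ≤ Γ.stack.length → (γ k).length = Γ.stack.width m k := by
    intro k
    induction k with
    | zero => intro _; rw [h0, hc, Stack.width_zero]
    | succ k ih =>
      intro hk
      rw [(hγ k (by omega)).length.2, ih (by omega), Stack.width_succ _ _ _ (by omega)]
  choose u v a hu hd hc' using hγ
  refine ⟨Sum.elim (fun p => (γ p.1)[(p.2 : ℕ)]'(by
    rw [hlen _ (by omega)]; exact p.2.2)) (fun k => a k k.2), ?_, ?_, ?_⟩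
  · rintro (⟨p, i⟩ | k) (⟨q, j⟩ | k') hL
    · obtain ⟨k, rfl, rfl, h⟩ := hL
      have h1 := hu k k.2
      simp only [List.get_eq_getElem] at h
      simp only [Sum.elim_inl, Fin.val_castSucc, Fin.val_succ, hd k k.2, hc' k k.2]
      rcases h with ⟨h, h'⟩ | ⟨h, h'⟩
      · simp only [List.append_assoc]
        rw [List.getElem_append_left (by omega), List.getElem_append_left (by omega)]
        simp [h']
      · rw [List.getElem_append_right (by simp; omega), List.getElem_append_right (by simp; omega)]
        congr 1
        simp; omega
    · obtain ⟨rfl, h, h'⟩ := hL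
      have h1 := hu k' k'.2
      simp only [List.get_eq_getElem] at h h'
      simp only [Sum.elim_inl, Sum.elim_inr, Fin.val_castSucc, hd k' k'.2]
      rw [List.getElem_append_left (by simp; omega), List.getElem_append_right (by omega)]
      simp
    · obtain ⟨rfl, h, h'⟩ := hL
      have h1 := hu k k.2
      simp only [List.get_eq_getElem] at h h'
      simp only [Sum.elim_inl, Sum.elim_inr, Fin.val_succ, hc' k k.2]
      rw [List.getElem_append_left (by simp; omega), List.getElem_append_right (by omega)]
      simp
    · exact hL.elim
  · apply List.ext_getElem
    · simp [crossSection, Stack.width_zero, hc]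
    · intro i h1 h2
      simp [crossSection, h0]
  · apply List.ext_getElem
    · have := hlen _ le_rfl
      simp [crossSection, ← hl, this]
    · intro i h1 h2
      simp [crossSection, hl]

end

theorem component_eq_of_link {v w : Γ.Vertex} (h : Γ.Link v w) :
    Γ.toGraph.connectedComponentMk v = Γ.toGraph.connectedComponentMk w := by
  by_cases hvw : v = w
  · rw [hvw]
  · exact SimpleGraph.ConnectedComponent.eq.2
      (SimpleGraph.Adj.reachable ((SimpleGraph.fromRel_adj _ _ _).2 ⟨hvw, .inl h⟩))

theorem eq_of_component_eq {α : Type*} {f : Γ.Vertex → α} (hf : ∀ v w, Γ.Link v w → f v = f w)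
    {v w : Γ.Vertex} (h : Γ.toGraph.connectedComponentMk v = Γ.toGraph.connectedComponentMk w) :
    f v = f w := by
  rw [SimpleGraph.ConnectedComponent.eq, SimpleGraph.reachable_iff_reflTransGen] at h
  induction h with
  | refl => rfl
  | tail _ hab ih =>
    rw [ih]
    rcases ((SimpleGraph.fromRel_adj _ _ _).1 hab).2 with h | h
    · exact hf _ _ h
    · exact (hf _ _ h).symm

/-- The colour of a boundary point, for given colours of the lower and the upper boundary. -/
def _root_.OneColor.boundaryColor {α : Type*} (lo hi : List α) : Fin m ⊕ Fin n → Option α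
  | .inl i => lo[(i : ℕ)]?
  | .inr j => hi[(j : ℕ)]?

theorem boundaryColor_crossSection {α : Type*} (f : Γ.Vertex → α) (x : Fin m ⊕ Fin n) :
    boundaryColor (Γ.crossSection f 0) (Γ.crossSection f (Fin.last _)) x =
      some (f (Γ.boundary x)) := by
  rcases x with i | j
  · have : (i : ℕ) < Γ.stack.width m 0 := i.2
    simp [boundaryColor, crossSection, this]; rfl
  · have : (j : ℕ) < Γ.stack.width m Γ.stack.length := by
      rw [Stack.width_length Γ.fits]; exact j.2
    simp [boundaryColor, crossSection, this]; rfl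

/-- Two boundary points lie in the same component exactly when no colouring tells them apart. -/
theorem componentAt_eq_iff (x y : Fin m ⊕ Fin n) :
    Γ.componentAt x = Γ.componentAt y ↔ ∀ c c' : List Prop, c.length = m →
      Stack.Colors c Γ.stack c' → boundaryColor c c' x = boundaryColor c c' y := by
  constructor
  · intro h c c' hc hcol
    obtain ⟨f, hf, rfl, rfl⟩ := exists_coloring hcol hc
    rw [boundaryColor_crossSection, boundaryColor_crossSection, Γ.eq_of_component_eq hf h]
  · intro h
    -- Colour every point by whether it lies in the component of `x`.
    have hf : ∀ v w, Γ.Link v w → (Γ.toGraph.connectedComponentMk v = Γ.componentAt x) =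
        (Γ.toGraph.connectedComponentMk w = Γ.componentAt x) := fun v w hL => by
      rw [Γ.component_eq_of_link hL]
    have := h _ _ (by simp [crossSection, Stack.width_zero]) (colors_crossSection hf)
    rw [boundaryColor_crossSection, boundaryColor_crossSection, Option.some_inj] at this
    exact (this.mp rfl).symm

end StripGraph

theorem Reduces.componentAt_eq_iff {m n : ℕ} {Γ F : StripGraph m n} (h : Reduces BasicMove Γ F)
    (x y : Fin m ⊕ Fin n) :
    Γ.componentAt x = Γ.componentAt y ↔ F.componentAt x = F.componentAt y := by
  rw [Γ.componentAt_eq_iff, F.componentAt_eq_iff]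
  exact forall_congr' fun c => forall_congr' fun c' => forall_congr' fun hc => by
    rw [h.colors_iff c c' hc]

theorem StripGraph.IsSimpleForest.exists_boundary {m n : ℕ} {F : StripGraph m n}
    (hF : F.IsSimpleForest) (C : F.Component) : ∃ x, F.componentAt x = C := by
  have : F.numBoundary C ≠ 0 := by
    rcases (hF C).2 with h | h <;> omega
  have := (Nat.card_ne_zero.1 this).1
  exact ⟨_, this.some.2⟩

/-- Both sets of components are quotients of the set of boundary points by the same relation. -/
theorem Reduces.exists_component_equiv {m n : ℕ} {Γ F : StripGraph m n}
    (h : Reduces BasicMove Γ F) (hF : F.IsSimpleForest) :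
    ∃ e : F.Component ≃ {C : Γ.Component // ∃ x, Γ.componentAt x = C},
      ∀ x : Fin m ⊕ Fin n, (e (F.componentAt x) : Γ.Component) = Γ.componentAt x := by
  choose x hx using hF.exists_boundary
  let e : F.Component → {C : Γ.Component // ∃ x, Γ.componentAt x = C} :=
    fun C => ⟨Γ.componentAt (x C), x C, rfl⟩
  have he : ∀ y, (e (F.componentAt y) : Γ.Component) = Γ.componentAt y := fun y =>
    (h.componentAt_eq_iff _ _).2 (hx _)
  refine ⟨Equiv.ofBijective e ⟨fun C D hCD => ?_, ?_⟩, he⟩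
  · rw [← hx C, ← hx D]
    exact (h.componentAt_eq_iff _ _).1 (congrArg Subtype.val hCD)
  · rintro ⟨_, y, rfl⟩
    exact ⟨F.componentAt y, Subtype.ext (he y)⟩

/-! ### Reductions inside a larger picture -/

theorem Stack.shift_append (a : ℕ) (s t : Stack) :
    Stack.shift a (s ++ t) = Stack.shift a s ++ Stack.shift a t := by
  simp [Stack.shift]

theorem Stack.shift_shift (a b : ℕ) (s : Stack) :
    Stack.shift a (Stack.shift b s) = Stack.shift (a + b) s := by
  simp [Stack.shift, Nat.add_assoc]

theorem Stack.shift_zero (s : Stack) : Stack.shift 0 s = s := by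
  simp [Stack.shift]

theorem Stack.Fits.context {m n w k a : ℕ} {lower s upper : Stack}
    (hl : Stack.Fits m lower (a + w)) (h : Stack.Fits w s k) (hu : Stack.Fits (a + k) upper n) :
    Stack.Fits m (lower ++ Stack.shift a s ++ upper) n :=
  Stack.fits_append.2 ⟨_, Stack.fits_append.2 ⟨_, hl, Stack.fits_shift.2 ⟨_, rfl, h⟩⟩, hu⟩

section Red
variable {R : Stack → Stack → Prop}

theorem LocalStep.context {m n w k a : ℕ} {lower upper : Stack}
    (hl : Stack.Fits m lower (a + w)) (hu : Stack.Fits (a + k) upper n) {Γ Γ' : StripGraph w k}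
    (h : LocalStep R Γ Γ') :
    LocalStep (m := m) (n := n) R ⟨_, hl.context Γ.fits hu⟩ ⟨_, hl.context Γ'.fits hu⟩ := by
  obtain ⟨lo, up, X, Y, b, hXY, h1, h2⟩ := h
  refine ⟨lower ++ Stack.shift a lo, Stack.shift a up ++ upper, X, Y, a + b, hXY, ?_, ?_⟩
  · simp only [h1, Stack.shift_append, Stack.shift_shift, List.append_assoc]
  · simp only [h2, Stack.shift_append, Stack.shift_shift, List.append_assoc]

theorem Reduces.context {m n w k a : ℕ} {lower upper : Stack}
    (hl : Stack.Fits m lower (a + w)) (hu : Stack.Fits (a + k) upper n) {Γ Γ' : StripGraph w k}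
    (h : Reduces R Γ Γ') :
    Reduces (m := m) (n := n) R ⟨_, hl.context Γ.fits hu⟩ ⟨_, hl.context Γ'.fits hu⟩ := by
  refine Relation.ReflTransGen.lift
    (fun Γ : StripGraph w k => (⟨_, hl.context Γ.fits hu⟩ : StripGraph m n)) ?_ _ _ h
  rintro Γ Γ' (h | h | h)
  · exact .inl (h.context hl hu)
  · exact .inr (.inl (h.context hl hu))
  · exact .inr (.inr (h.context hl hu))

/-- Every picture with `w` strands at the bottom that is given by the stack `s` reduces to one given
by `t`. Nothing is claimed if `s` does not fit on `w` strands. -/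
def RedAt (R : Stack → Stack → Prop) (w : ℕ) (s t : Stack) : Prop :=
  ∀ (n : ℕ) (h : Stack.Fits w s n), ∃ h' : Stack.Fits w t n, Reduces R ⟨s, h⟩ ⟨t, h'⟩

/-- `s` reduces to `t`, whatever the number of strands. -/
def Red (R : Stack → Stack → Prop) (s t : Stack) : Prop := ∀ w, RedAt R w s t

theorem RedAt.refl (w : ℕ) (s : Stack) : RedAt R w s s := fun _ h => ⟨h, .refl⟩

theorem RedAt.trans {w : ℕ} {s t u : Stack} (h1 : RedAt R w s t) (h2 : RedAt R w t u) :
    RedAt R w s u := fun n h => by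
  obtain ⟨h', r1⟩ := h1 n h
  obtain ⟨h'', r2⟩ := h2 n h'
  exact ⟨h'', Relation.ReflTransGen.trans r1 r2⟩

theorem Red.refl (s : Stack) : Red R s s := fun w => .refl w s

theorem Red.trans {s t u : Stack} (h1 : Red R s t) (h2 : Red R t u) : Red R s u :=
  fun w => (h1 w).trans (h2 w)

theorem RedAt.context {m a : ℕ} {lower s t : Stack} (upper : Stack)
    (h : ∀ k, Stack.Fits m lower k → ∀ k', Stack.Fits k (Stack.shift a s) k' →
      ∃ w, k = a + w ∧ RedAt R w s t) :
    RedAt R m (lower ++ Stack.shift a s ++ upper) (lower ++ Stack.shift a t ++ upper) := by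
  intro n hn
  obtain ⟨k', h1, hu⟩ := Stack.fits_append.1 hn
  obtain ⟨k, hl, h1⟩ := Stack.fits_append.1 h1
  obtain ⟨w, rfl, hst⟩ := h k hl k' h1
  obtain ⟨j, rfl, hs⟩ := Stack.fits_shift.1 h1
  obtain ⟨ht, hr⟩ := hst j hs
  exact ⟨_, hr.context hl hu⟩

theorem RedAt.append_right {m : ℕ} {s t : Stack} (h : RedAt R m s t) (upper : Stack) :
    RedAt R m (s ++ upper) (t ++ upper) := by
  have := RedAt.context (R := R) (m := m) (a := 0) (lower := []) (s := s) (t := t) upper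
    (fun k hk _ _ => ⟨k, by simp, by obtain rfl : m = k := hk; exact h⟩)
  simpa [Stack.shift_zero] using this

theorem RedAt.append_left {m : ℕ} {s t : Stack} (lower : Stack)
    (h : ∀ k, Stack.Fits m lower k → RedAt R k s t) : RedAt R m (lower ++ s) (lower ++ t) := by
  have := RedAt.context (R := R) (m := m) (a := 0) (lower := lower) (s := s) (t := t) []
    (fun k hk _ _ => ⟨k, by simp, h k hk⟩)
  simpa [Stack.shift_zero] using this

theorem Red.append_right {s t : Stack} (h : Red R s t) (upper : Stack) :
    Red R (s ++ upper) (t ++ upper) := fun w => (h w).append_right upper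

theorem Red.append_left {s t : Stack} (lower : Stack) (h : Red R s t) :
    Red R (lower ++ s) (lower ++ t) := fun _ => RedAt.append_left lower fun k _ => h k

/-- A reduction may be applied inside a larger picture. The subdiagram must not be empty, since an
empty stack says nothing about the number of strands that are present. -/
theorem Red.context (lower : Stack) {s t : Stack} (upper : Stack) (a : ℕ) (h : Red R s t)
    (hs : s ≠ []) :
    Red R (lower ++ Stack.shift a s ++ upper) (lower ++ Stack.shift a t ++ upper) := by
  intro m
  refine RedAt.context upper fun k _ k' hk' => ⟨k - a, ?_, h _⟩
  by_contra hk
  exact hs (Stack.eq_nil_of_fits_shift hk' (by omega))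

theorem Red.shift {s t : Stack} (a : ℕ) (h : Red R s t) (hs : s ≠ []) :
    Red R (Stack.shift a s) (Stack.shift a t) := by
  simpa using h.context [] [] a hs

theorem RedAt.of_step {w : ℕ} {s t : Stack} (hf : ∀ n, Stack.Fits w s n → Stack.Fits w t n)
    (h : IsotopyRule s t ∨ IsotopyRule t s ∨ R s t) : RedAt R w s t := by
  intro n hn
  refine ⟨hf n hn, .single ?_⟩
  rcases h with h | h | h
  · exact .inl ⟨[], [], s, t, 0, h, by simp [Stack.shift_zero], by simp [Stack.shift_zero]⟩
  · exact .inr (.inl ⟨[], [], t, s, 0, h, by simp [Stack.shift_zero], by simp [Stack.shift_zero]⟩)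
  · exact .inr (.inr ⟨[], [], s, t, 0, h, by simp [Stack.shift_zero], by simp [Stack.shift_zero]⟩)

theorem IsotopyRule.red {X Y : Stack} (h : IsotopyRule X Y) : Red R X Y := fun w => by
  refine RedAt.of_step (fun n => ?_) (.inl h)
  cases h <;> simp only [Stack.Fits, Layer.next, Piece.dom, Piece.cod] <;> omega

/-- An isotopy may be read backwards, unless it creates a zigzag on a strand: then that strand must
be known to be there. -/
theorem IsotopyRule.red_symm {X Y : Stack} (h : IsotopyRule X Y) (hY : Y ≠ []) : Red R Y X :=
    fun w => by
  refine RedAt.of_step (fun n => ?_) (.inr (.inl h))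
  cases h <;> simp only [Stack.Fits, Layer.next, Piece.dom, Piece.cod] <;>
    first | omega | simp at hY

theorem BasicMove.red {X Y : Stack} (h : BasicMove X Y) : Red BasicMove X Y := fun w => by
  refine RedAt.of_step (fun n => ?_) (.inr (.inr h))
  cases h <;> simp only [Stack.Fits, Layer.next, Piece.dom, Piece.cod] <;> omega

theorem red_exchange_left (p q : ℕ) (h g : Piece) (hpq : q + g.dom ≤ p) :
    Red R [⟨p, h⟩, ⟨q, g⟩] [⟨q, g⟩, ⟨p - g.dom + g.cod, h⟩] := by
  have := ((IsotopyRule.exchange g h (p - q - g.dom)).red_symm (R := R) (by simp)).shift q (by simp)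
  convert this using 1
  · simp [Stack.shift]; omega
  · simp [Stack.shift]; omega

theorem red_exchange_right (p q : ℕ) (h g : Piece) (hpq : p + h.cod ≤ q) :
    Red R [⟨p, h⟩, ⟨q, g⟩] [⟨q - h.cod + h.dom, g⟩, ⟨p, h⟩] := by
  have := ((IsotopyRule.exchange h g (q - p - h.cod)).red (R := R)).shift p (by simp)
  convert this using 1
  · simp [Stack.shift]; omega
  · simp [Stack.shift]; omega

end Red

/-! ### Local relations -/

open Piece

theorem red_counit_right : Red BasicMove [⟨0, split⟩, ⟨1, endDot⟩] [] := by
  have h1 : Red BasicMove [⟨0, split⟩, ⟨1, endDot⟩] [⟨0, cup⟩, ⟨1, merge⟩, ⟨1, endDot⟩] :=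
    (IsotopyRule.twistMergeLeft.red_symm (by simp)).context [] [⟨1, endDot⟩] 0 (by simp)
  have h2 : Red BasicMove [⟨0, cup⟩, ⟨1, merge⟩, ⟨1, endDot⟩] [⟨0, cup⟩, ⟨1, cap⟩] :=
    BasicMove.dotContraction.red.context [⟨0, cup⟩] [] 1 (by simp)
  exact (h1.trans h2).trans IsotopyRule.zigzagRight.red

theorem red_counit_left : Red BasicMove [⟨0, split⟩, ⟨0, endDot⟩] [] := by
  have h1 : Red BasicMove [⟨0, split⟩, ⟨0, endDot⟩] [⟨1, cup⟩, ⟨0, merge⟩, ⟨0, endDot⟩] :=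
    (IsotopyRule.twistMergeRight.red_symm (by simp)).context [] [⟨0, endDot⟩] 0 (by simp)
  have h2 : Red BasicMove [⟨1, cup⟩, ⟨0, merge⟩, ⟨0, endDot⟩] [⟨1, cup⟩, ⟨0, cap⟩] :=
    BasicMove.dotContraction.red.context [⟨1, cup⟩] [] 0 (by simp)
  exact (h1.trans h2).trans IsotopyRule.zigzagLeft.red

theorem red_unit_right : Red BasicMove [⟨1, startDot⟩, ⟨0, merge⟩] [] := by
  have h1 : Red BasicMove [⟨1, startDot⟩, ⟨0, merge⟩] [⟨1, startDot⟩, ⟨0, split⟩, ⟨1, cap⟩] :=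
    (IsotopyRule.twistSplitRight.red_symm (by simp)).context [⟨1, startDot⟩] [] 0 (by simp)
  have h2 : Red BasicMove [⟨1, startDot⟩, ⟨0, split⟩, ⟨1, cap⟩]
      [⟨0, split⟩, ⟨2, startDot⟩, ⟨1, cap⟩] :=
    (red_exchange_left 1 0 startDot split (by simp [dom])).context [] [⟨1, cap⟩] 0 (by simp)
  have h3 : Red BasicMove [⟨0, split⟩, ⟨2, startDot⟩, ⟨1, cap⟩] [⟨0, split⟩, ⟨1, endDot⟩] :=
    IsotopyRule.twistStartRight.red.context [⟨0, split⟩] [] 1 (by simp)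
  exact ((h1.trans h2).trans h3).trans red_counit_right

theorem red_unit_left : Red BasicMove [⟨0, startDot⟩, ⟨0, merge⟩] [] := by
  have h1 : Red BasicMove [⟨0, startDot⟩, ⟨0, merge⟩] [⟨0, startDot⟩, ⟨1, split⟩, ⟨0, cap⟩] :=
    (IsotopyRule.twistSplitLeft.red_symm (by simp)).context [⟨0, startDot⟩] [] 0 (by simp)
  have h2 : Red BasicMove [⟨0, startDot⟩, ⟨1, split⟩, ⟨0, cap⟩]
      [⟨0, split⟩, ⟨0, startDot⟩, ⟨0, cap⟩] :=
    (red_exchange_right 0 1 startDot split (by simp [cod])).context [] [⟨0, cap⟩] 0 (by simp)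
  have h3 : Red BasicMove [⟨0, split⟩, ⟨0, startDot⟩, ⟨0, cap⟩] [⟨0, split⟩, ⟨0, endDot⟩] :=
    IsotopyRule.twistStartLeft.red.context [⟨0, split⟩] [] 0 (by simp)
  exact ((h1.trans h2).trans h3).trans red_counit_left

/-- The associativity move, with the middle edge of the H-shaped tree sloping the other way. -/
theorem red_frobenius_left :
    Red BasicMove [⟨1, split⟩, ⟨0, merge⟩] [⟨0, merge⟩, ⟨0, split⟩] := by
  have h1 : Red BasicMove [⟨1, split⟩, ⟨0, merge⟩] [⟨1, split⟩, ⟨0, split⟩, ⟨1, cap⟩] :=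
    (IsotopyRule.twistSplitRight.red_symm (by simp)).context [⟨1, split⟩] [] 0 (by simp)
  have h2 : Red BasicMove [⟨1, split⟩, ⟨0, split⟩, ⟨1, cap⟩]
      [⟨0, split⟩, ⟨2, split⟩, ⟨1, cap⟩] :=
    (red_exchange_left 1 0 split split (by simp [dom])).context [] [⟨1, cap⟩] 0 (by simp)
  have h3 : Red BasicMove [⟨0, split⟩, ⟨2, split⟩, ⟨1, cap⟩] [⟨0, split⟩, ⟨1, merge⟩] :=
    IsotopyRule.twistSplitLeft.red.context [⟨0, split⟩] [] 1 (by simp)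
  exact ((h1.trans h2).trans h3).trans BasicMove.assocRotated.red

/-- A digon on a strand disappears: associativity turns it into a needle attached to the strand. -/
theorem red_bubble : Red BasicMove [⟨0, split⟩, ⟨0, merge⟩] [] := by
  have h1 : Red BasicMove [⟨0, split⟩, ⟨0, merge⟩] [⟨0, split⟩, ⟨0, split⟩, ⟨1, cap⟩] :=
    (IsotopyRule.twistSplitRight.red_symm (by simp)).context [⟨0, split⟩] [] 0 (by simp)
  have h2 : Red BasicMove [⟨0, split⟩, ⟨0, split⟩, ⟨1, cap⟩]
      [⟨0, split⟩, ⟨0, cup⟩, ⟨1, merge⟩, ⟨1, cap⟩] :=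
    (IsotopyRule.twistMergeLeft.red_symm (by simp)).context [⟨0, split⟩] [⟨1, cap⟩] 0 (by simp)
  have h3 : Red BasicMove [⟨0, split⟩, ⟨0, cup⟩, ⟨1, merge⟩, ⟨1, cap⟩]
      [⟨0, cup⟩, ⟨2, split⟩, ⟨1, merge⟩, ⟨1, cap⟩] :=
    (red_exchange_left 0 0 split cup (by simp [dom])).context [] [⟨1, merge⟩, ⟨1, cap⟩] 0 (by simp)
  have h4 : Red BasicMove [⟨0, cup⟩, ⟨2, split⟩, ⟨1, merge⟩, ⟨1, cap⟩]
      [⟨0, cup⟩, ⟨1, merge⟩, ⟨1, split⟩, ⟨1, cap⟩] :=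
    red_frobenius_left.context [⟨0, cup⟩] [⟨1, cap⟩] 1 (by simp)
  have h5 : Red BasicMove [⟨0, cup⟩, ⟨1, merge⟩, ⟨1, split⟩, ⟨1, cap⟩]
      [⟨0, cup⟩, ⟨1, merge⟩, ⟨1, endDot⟩] :=
    BasicMove.needle.red.context [⟨0, cup⟩, ⟨1, merge⟩] [] 1 (by simp)
  have h6 : Red BasicMove [⟨0, cup⟩, ⟨1, merge⟩, ⟨1, endDot⟩] [⟨0, cup⟩, ⟨1, cap⟩] :=
    BasicMove.dotContraction.red.context [⟨0, cup⟩] [] 1 (by simp)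
  exact (((((h1.trans h2).trans h3).trans h4).trans h5).trans h6).trans IsotopyRule.zigzagRight.red

/-- The needle move for a loop below its stem: rotating the trivalent vertex against the minimum
turns the loop into one that lies above its vertex. -/
theorem red_needle_below : Red BasicMove [⟨0, cup⟩, ⟨0, merge⟩] [⟨0, startDot⟩] := by
  have h1 : Red BasicMove [⟨0, cup⟩, ⟨0, merge⟩] [⟨0, cup⟩, ⟨0, split⟩, ⟨1, cap⟩] :=
    (IsotopyRule.twistSplitRight.red_symm (by simp)).context [⟨0, cup⟩] [] 0 (by simp)
  have h2 : Red BasicMove [⟨0, cup⟩, ⟨0, split⟩, ⟨1, cap⟩]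
      [⟨0, cup⟩, ⟨0, cup⟩, ⟨1, merge⟩, ⟨1, cap⟩] :=
    (IsotopyRule.twistMergeLeft.red_symm (by simp)).context [⟨0, cup⟩] [⟨1, cap⟩] 0 (by simp)
  have h3 : Red BasicMove [⟨0, cup⟩, ⟨0, cup⟩, ⟨1, merge⟩, ⟨1, cap⟩]
      [⟨0, cup⟩, ⟨2, cup⟩, ⟨1, merge⟩, ⟨1, cap⟩] :=
    (red_exchange_left 0 0 cup cup (by simp [dom])).context [] [⟨1, merge⟩, ⟨1, cap⟩] 0 (by simp)
  have h4 : Red BasicMove [⟨0, cup⟩, ⟨2, cup⟩, ⟨1, merge⟩, ⟨1, cap⟩]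
      [⟨0, cup⟩, ⟨1, split⟩, ⟨1, cap⟩] :=
    IsotopyRule.twistMergeRight.red.context [⟨0, cup⟩] [⟨1, cap⟩] 1 (by simp)
  have h5 : Red BasicMove [⟨0, cup⟩, ⟨1, split⟩, ⟨1, cap⟩] [⟨0, cup⟩, ⟨1, endDot⟩] :=
    BasicMove.needle.red.context [⟨0, cup⟩] [] 1 (by simp)
  exact ((((h1.trans h2).trans h3).trans h4).trans h5).trans IsotopyRule.twistEndRight.red

theorem red_circle : Red BasicMove [⟨0, cup⟩, ⟨0, cap⟩] [] := by
  have h1 : Red BasicMove [⟨0, cup⟩, ⟨0, cap⟩] [⟨0, cup⟩, ⟨0, merge⟩, ⟨0, endDot⟩] :=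
    BasicMove.dotExpansion.red.context [⟨0, cup⟩] [] 0 (by simp)
  have h2 : Red BasicMove [⟨0, cup⟩, ⟨0, merge⟩, ⟨0, endDot⟩] [⟨0, startDot⟩, ⟨0, endDot⟩] :=
    red_needle_below.context [] [⟨0, endDot⟩] 0 (by simp)
  exact (h1.trans h2).trans BasicMove.doubleDotRemoval.red

/-- A dot below a trivalent vertex is contracted. -/
theorem red_startDot_split : Red BasicMove [⟨0, startDot⟩, ⟨0, split⟩] [⟨0, cup⟩] := by
  have h1 : Red BasicMove [⟨0, startDot⟩, ⟨0, split⟩] [⟨0, startDot⟩, ⟨0, cup⟩, ⟨1, merge⟩] :=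
    (IsotopyRule.twistMergeLeft.red_symm (by simp)).context [⟨0, startDot⟩] [] 0 (by simp)
  have h2 : Red BasicMove [⟨0, startDot⟩, ⟨0, cup⟩, ⟨1, merge⟩]
      [⟨0, cup⟩, ⟨2, startDot⟩, ⟨1, merge⟩] :=
    (red_exchange_left 0 0 startDot cup (by simp [dom])).context [] [⟨1, merge⟩] 0 (by simp)
  have h3 : Red BasicMove [⟨0, cup⟩, ⟨2, startDot⟩, ⟨1, merge⟩] [⟨0, cup⟩] :=
    red_unit_right.context [⟨0, cup⟩] [] 1 (by simp)
  exact (h1.trans h2).trans h3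

/-! ### Sorting the pieces of a stack -/

section Sorting
variable {R : Stack → Stack → Prop} {P Q : Piece → Prop}

/-- Every piece of the stack satisfies `P`. -/
def Stack.All (P : Piece → Prop) (s : Stack) : Prop := ∀ l ∈ s, P l.piece

theorem Stack.All.nil : Stack.All P [] := by simp [Stack.All]

theorem Stack.all_cons {l : Layer} {s : Stack} :
    Stack.All P (l :: s) ↔ P l.piece ∧ Stack.All P s := by simp [Stack.All]

theorem Stack.all_append {s t : Stack} :
    Stack.All P (s ++ t) ↔ Stack.All P s ∧ Stack.All P t := by
  simp [Stack.All, or_imp, forall_and]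

theorem Stack.all_shift {s : Stack} {a : ℕ} : Stack.All P (Stack.shift a s) ↔ Stack.All P s := by
  simp [Stack.All, Stack.shift]

/-- The stack has at most one piece satisfying `P`, and above it at most one satisfying `Q`. -/
def SortedPair (P Q : Piece → Prop) (t : Stack) : Prop :=
  ∃ A B : Stack, t = A ++ B ∧ A.length ≤ 1 ∧ B.length ≤ 1 ∧ A.All P ∧ B.All Q

theorem SortedPair.nil : SortedPair P Q [] :=
  ⟨[], [], rfl, by simp, by simp, .nil, .nil⟩

theorem SortedPair.left {l : Layer} (h : P l.piece) : SortedPair P Q [l] :=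
  ⟨[l], [], rfl, by simp, by simp, Stack.all_cons.2 ⟨h, .nil⟩, .nil⟩

theorem SortedPair.right {l : Layer} (h : Q l.piece) : SortedPair P Q [l] :=
  ⟨[], [l], rfl, by simp, by simp, .nil, Stack.all_cons.2 ⟨h, .nil⟩⟩

theorem SortedPair.pair {l l' : Layer} (h : P l.piece) (h' : Q l'.piece) :
    SortedPair P Q [l, l'] :=
  ⟨[l], [l'], rfl, by simp, by simp, Stack.all_cons.2 ⟨h, .nil⟩, Stack.all_cons.2 ⟨h', .nil⟩⟩

theorem SortedPair.shift {t : Stack} (a : ℕ) (h : SortedPair P Q t) :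
    SortedPair P Q (Stack.shift a t) := by
  obtain ⟨A, B, rfl, hA, hB, hA', hB'⟩ := h
  exact ⟨_, _, Stack.shift_append _ _ _, by simpa [Stack.shift] using hA,
    by simpa [Stack.shift] using hB, Stack.all_shift.2 hA', Stack.all_shift.2 hB'⟩

/-- To move a piece `g` below a piece `h`, it is enough to treat the positions in which the two
pieces share a strand; otherwise their heights are exchanged by an isotopy. -/
theorem exists_red_sortedPair {h g : Piece} (hg : P g) (hh : Q h)
    (hov : ∀ i j, i = 0 ∨ j = 0 → i < j + g.dom → j < i + h.cod →
      ∃ t, Red R [⟨i, h⟩, ⟨j, g⟩] t ∧ SortedPair P Q t) (p q : ℕ) :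
    ∃ t, Red R [⟨p, h⟩, ⟨q, g⟩] t ∧ SortedPair P Q t := by
  by_cases h1 : q + g.dom ≤ p
  · exact ⟨_, red_exchange_left p q h g h1, .pair hg hh⟩
  by_cases h2 : p + h.cod ≤ q
  · exact ⟨_, red_exchange_right p q h g h2, .pair hg hh⟩
  obtain ⟨t, ht, hs⟩ := hov (p - min p q) (q - min p q) (by omega) (by omega) (by omega)
  refine ⟨_, ?_, hs.shift (min p q)⟩
  have := ht.shift (min p q) (by simp)
  convert this using 1
  simp [Stack.shift]

/-- If pieces satisfying `P` can be moved below pieces satisfying `Q`, then a stack of such pieces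
can be sorted. -/
theorem exists_red_sorted (hswap : ∀ h g : Piece, Q h → P g → ∀ p q,
      ∃ t, Red R [⟨p, h⟩, ⟨q, g⟩] t ∧ SortedPair P Q t) (s : Stack)
    (hs : s.All fun g => P g ∨ Q g) :
    ∃ A B : Stack, A.All P ∧ B.All Q ∧ Red R s (A ++ B) := by
  -- One piece satisfying `P` is moved down through a stack of pieces satisfying `Q`.
  have insert : ∀ (B : Stack), B.All Q → ∀ l : Layer, P l.piece →
      ∃ A' B' : Stack, A'.All P ∧ B'.All Q ∧ Red R (B ++ [l]) (A' ++ B') := by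
    intro B
    induction B using List.reverseRecOn with
    | nil => exact fun _ l hl => ⟨[l], [], Stack.all_cons.2 ⟨hl, .nil⟩, .nil, .refl _⟩
    | append_singleton B b ih =>
      intro hB l hl
      rw [Stack.all_append] at hB
      obtain ⟨t, ht, X, Y, rfl, hX, hY, hX', hY'⟩ :=
        hswap b.piece l.piece (Stack.all_cons.1 hB.2).1 hl b.pos l.pos
      have h1 : Red R (B ++ [b] ++ [l]) (B ++ X ++ Y) := by
        have := ht.context B [] 0 (by simp)
        simpa [Stack.shift_zero] using this
      rcases X with _ | ⟨x, _ | ⟨y, X⟩⟩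
      · exact ⟨[], B ++ Y, .nil, Stack.all_append.2 ⟨hB.1, hY'⟩, by simpa using h1⟩
      · obtain ⟨A', B', hA, hB', hr⟩ := ih hB.1 x (Stack.all_cons.1 hX').1
        refine ⟨A', B' ++ Y, hA, Stack.all_append.2 ⟨hB', hY'⟩, h1.trans ?_⟩
        simpa using hr.append_right Y
      · simp at hX
  induction s using List.reverseRecOn with
  | nil => exact ⟨[], [], .nil, .nil, .refl _⟩
  | append_singleton s l ih =>
    rw [Stack.all_append, Stack.all_cons] at hs
    obtain ⟨A, B, hA, hB, hr⟩ := ih hs.1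
    have h1 := hr.append_right [l]
    rcases hs.2.1 with hl | hl
    · obtain ⟨A', B', hA', hB', hr'⟩ := insert B hB l hl
      refine ⟨A ++ A', B', Stack.all_append.2 ⟨hA, hA'⟩, hB', h1.trans ?_⟩
      rw [List.append_assoc, List.append_assoc]
      exact hr'.append_left A
    · exact ⟨A, B ++ [l], hA, Stack.all_append.2 ⟨hB, Stack.all_cons.2 ⟨hl, .nil⟩⟩,
        by simpa using h1⟩

end Sorting

/-- The pieces that do not increase the number of strands. -/
def IsLower (g : Piece) : Prop := g = endDot ∨ g = merge ∨ g = cap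

/-- The pieces that do not decrease the number of strands. -/
def IsUpper (g : Piece) : Prop := g = startDot ∨ g = split ∨ g = cup

theorem isLower_or_isUpper (g : Piece) : IsLower g ∨ IsUpper g := by
  cases g <;> simp [IsLower, IsUpper]

/-- A lower piece can be moved below an upper piece. Each pair that shares a strand is handled by
one local relation. -/
theorem swap_lower_upper (h g : Piece) (hh : IsUpper h) (hg : IsLower g) (p q : ℕ) :
    ∃ t, Red BasicMove [⟨p, h⟩, ⟨q, g⟩] t ∧ SortedPair IsLower IsUpper t := by
  have e : IsLower endDot := .inl rfl
  have m : IsLower merge := .inr (.inl rfl)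
  have s : IsUpper startDot := .inl rfl
  have y : IsUpper split := .inr (.inl rfl)
  refine exists_red_sortedPair hg hh (fun i j h0 hi hj => ?_) p q
  rcases hh with rfl | rfl | rfl <;> rcases hg with rfl | rfl | rfl <;>
    simp only [dom, cod] at hi hj <;> rcases h0 with rfl | rfl
  · obtain rfl : j = 0 := by omega
    exact ⟨_, BasicMove.doubleDotRemoval.red, .nil⟩
  · obtain rfl : i = 0 := by omega
    exact ⟨_, BasicMove.doubleDotRemoval.red, .nil⟩
  · obtain rfl : j = 0 := by omega
    exact ⟨_, red_unit_left, .nil⟩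
  · obtain rfl | rfl : i = 0 ∨ i = 1 := by omega
    · exact ⟨_, red_unit_left, .nil⟩
    · exact ⟨_, red_unit_right, .nil⟩
  · obtain rfl : j = 0 := by omega
    exact ⟨_, IsotopyRule.twistStartLeft.red, .left e⟩
  · obtain rfl | rfl : i = 0 ∨ i = 1 := by omega
    · exact ⟨_, IsotopyRule.twistStartLeft.red, .left e⟩
    · exact ⟨_, IsotopyRule.twistStartRight.red, .left e⟩
  · obtain rfl | rfl : j = 0 ∨ j = 1 := by omega
    · exact ⟨_, red_counit_left, .nil⟩
    · exact ⟨_, red_counit_right, .nil⟩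
  · obtain rfl : i = 0 := by omega
    exact ⟨_, red_counit_left, .nil⟩
  · obtain rfl | rfl : j = 0 ∨ j = 1 := by omega
    · exact ⟨_, red_bubble, .nil⟩
    · exact ⟨_, BasicMove.assocRotated.red, .pair m y⟩
  · obtain rfl | rfl : i = 0 ∨ i = 1 := by omega
    · exact ⟨_, red_bubble, .nil⟩
    · exact ⟨_, red_frobenius_left, .pair m y⟩
  · obtain rfl | rfl : j = 0 ∨ j = 1 := by omega
    · exact ⟨_, BasicMove.needle.red, .left e⟩
    · exact ⟨_, IsotopyRule.twistSplitRight.red, .left m⟩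
  · obtain rfl | rfl : i = 0 ∨ i = 1 := by omega
    · exact ⟨_, BasicMove.needle.red, .left e⟩
    · exact ⟨_, IsotopyRule.twistSplitLeft.red, .left m⟩
  · obtain rfl | rfl : j = 0 ∨ j = 1 := by omega
    · exact ⟨_, IsotopyRule.twistEndLeft.red, .right s⟩
    · exact ⟨_, IsotopyRule.twistEndRight.red, .right s⟩
  · obtain rfl : i = 0 := by omega
    exact ⟨_, IsotopyRule.twistEndLeft.red, .right s⟩
  · obtain rfl | rfl : j = 0 ∨ j = 1 := by omega
    · exact ⟨_, red_needle_below, .right s⟩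
    · exact ⟨_, IsotopyRule.twistMergeLeft.red, .right y⟩
  · obtain rfl | rfl : i = 0 ∨ i = 1 := by omega
    · exact ⟨_, red_needle_below, .right s⟩
    · exact ⟨_, IsotopyRule.twistMergeRight.red, .right y⟩
  · obtain rfl | rfl : j = 0 ∨ j = 1 := by omega
    · exact ⟨_, red_circle, .nil⟩
    · exact ⟨_, IsotopyRule.zigzagRight.red, .nil⟩
  · obtain rfl | rfl : i = 0 ∨ i = 1 := by omega
    · exact ⟨_, red_circle, .nil⟩
    · exact ⟨_, IsotopyRule.zigzagLeft.red, .nil⟩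

/-- A dot on top of a merge turns it into a maximum, hence dots can be moved to the bottom. -/
theorem swap_endDot (h g : Piece) (hh : h = merge ∨ h = cap) (hg : g = endDot) (p q : ℕ) :
    ∃ t, Red BasicMove [⟨p, h⟩, ⟨q, g⟩] t ∧
      SortedPair (· = endDot) (fun h => h = merge ∨ h = cap) t := by
  refine exists_red_sortedPair (P := (· = endDot)) (Q := fun h => h = merge ∨ h = cap) hg hh
    (fun i j h0 hi hj => ?_) p q
  subst hg
  rcases hh with rfl | rfl <;> simp only [dom, cod] at hi hj
  · obtain ⟨rfl, rfl⟩ : i = 0 ∧ j = 0 := by omega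
    exact ⟨_, BasicMove.dotContraction.red, .right (.inr rfl)⟩
  · omega

/-- A dot below a split turns it into a minimum, hence dots can be moved to the top. -/
theorem swap_startDot (h g : Piece) (hh : h = startDot) (hg : g = split ∨ g = cup) (p q : ℕ) :
    ∃ t, Red BasicMove [⟨p, h⟩, ⟨q, g⟩] t ∧
      SortedPair (fun g => g = split ∨ g = cup) (· = startDot) t := by
  refine exists_red_sortedPair (P := fun g => g = split ∨ g = cup) (Q := (· = startDot)) hg hh
    (fun i j h0 hi hj => ?_) p q
  subst hh
  rcases hg with rfl | rfl <;> simp only [dom, cod] at hi hj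
  · obtain ⟨rfl, rfl⟩ : i = 0 ∧ j = 0 := by omega
    exact ⟨_, red_startDot_split, .left (.inr rfl)⟩
  · omega

theorem exists_red_lower_upper (s : Stack) :
    ∃ D U : Stack, D.All IsLower ∧ U.All IsUpper ∧ Red BasicMove s (D ++ U) :=
  exists_red_sorted swap_lower_upper s fun l _ => isLower_or_isUpper l.piece

/-- Every stack reduces to one in which the upper dots come first, next to the lower line, then
merges and maxima, then splits and minima, and last the lower dots. -/
theorem exists_red_forest (s : Stack) :
    ∃ E M W T : Stack, E.All (· = endDot) ∧ M.All (fun g => g = merge ∨ g = cap) ∧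
      W.All (fun g => g = split ∨ g = cup) ∧ T.All (· = startDot) ∧
      Red BasicMove s ((E ++ M) ++ (W ++ T)) := by
  obtain ⟨D, U, hD, hU, hr⟩ := exists_red_lower_upper s
  obtain ⟨E, M, hE, hM, hr1⟩ := exists_red_sorted swap_endDot D hD
  obtain ⟨W, T, hW, hT, hr2⟩ := exists_red_sorted swap_startDot U fun l hl => (hU l hl).symm
  exact ⟨E, M, W, T, hE, hM, hW, hT,
    (hr.trans (hr1.append_right U)).trans (hr2.append_left (E ++ M))⟩

/-! ### Edges directed towards the waist -/

theorem IsLower.cod_le_one {g : Piece} (h : IsLower g) : g.cod ≤ 1 := by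
  rcases h with rfl | rfl | rfl <;> simp [cod]

theorem IsUpper.dom_le_one {g : Piece} (h : IsUpper g) : g.dom ≤ 1 := by
  rcases h with rfl | rfl | rfl <;> simp [dom]

namespace StripGraph
variable {m n : ℕ} (Γ : StripGraph m n)

theorem pos_add_dom_le (k : Fin Γ.stack.length) :
    (Γ.stack.get k).pos + (Γ.stack.get k).piece.dom ≤ Γ.stack.width m k :=
  Γ.fits.get k k.2

theorem width_succ_add (k : Fin Γ.stack.length) :
    Γ.stack.width m (k + 1) + (Γ.stack.get k).piece.dom =
      Γ.stack.width m k + (Γ.stack.get k).piece.cod := by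
  have h1 := Γ.pos_add_dom_le k
  have h2 : _ = (Γ.stack.get k).next _ := Stack.width_succ m Γ.stack k k.2
  rw [h2, Layer.next]
  omega

/-- The layer in which the links that start at a point and go upwards lie. -/
def layerOf : Γ.Vertex → ℕ
  | .inl p => p.1
  | .inr k => k

/-- Twice the height of a point. -/
def twiceHeight : Γ.Vertex → ℕ
  | .inl p => 2 * p.1
  | .inr k => 2 * k + 1

variable {Γ}

theorem Link.height {v w : Γ.Vertex} (h : Γ.Link v w) :
    2 * Γ.layerOf v ≤ Γ.twiceHeight v ∧ Γ.twiceHeight v < Γ.twiceHeight w ∧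
      Γ.twiceHeight w ≤ 2 * Γ.layerOf v + 2 ∧ Γ.layerOf v < Γ.stack.length := by
  rcases v with ⟨p, i⟩ | k <;> rcases w with ⟨q, j⟩ | k'
  · obtain ⟨k, rfl, rfl, -⟩ := h
    simp [layerOf, twiceHeight]; omega
  · obtain ⟨rfl, -⟩ := h
    simp [layerOf, twiceHeight]
  · obtain ⟨rfl, -⟩ := h
    simp [layerOf, twiceHeight]; omega
  · exact h.elim

theorem Link.layerOf_le {v w : Γ.Vertex} (h : Γ.Link v w) : Γ.layerOf v ≤ Γ.layerOf w := by
  rcases v with ⟨p, i⟩ | k <;> rcases w with ⟨q, j⟩ | k'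
  · obtain ⟨k, rfl, rfl, -⟩ := h
    simp [layerOf]
  · obtain ⟨rfl, -⟩ := h
    simp [layerOf]
  · obtain ⟨rfl, -⟩ := h
    simp [layerOf]
  · exact h.elim

/-- A point has at most one link upwards if the piece of that layer has at most one upper leg. -/
theorem Link.right_unique {v w w' : Γ.Vertex} (h : Γ.Link v w) (h' : Γ.Link v w')
    (hcod : ∀ k : Fin Γ.stack.length, (k : ℕ) = Γ.layerOf v → (Γ.stack.get k).piece.cod ≤ 1) :
    w = w' := by
  rcases v with ⟨p, i⟩ | k
  · rcases w with ⟨q, j⟩ | k <;> rcases w' with ⟨q', j'⟩ | k'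
    · obtain ⟨k, rfl, rfl, h⟩ := h
      obtain ⟨k', hk, rfl, h'⟩ := h'
      obtain rfl := Fin.castSucc_injective _ hk
      have : (j : ℕ) = j' := by dsimp only at h h'; omega
      rw [Fin.ext this]
    · obtain ⟨k, rfl, rfl, h⟩ := h
      obtain ⟨hk, h'⟩ := h'
      obtain rfl := Fin.castSucc_injective _ hk
      dsimp only at h h'; omega
    · obtain ⟨k', rfl, rfl, h'⟩ := h'
      obtain ⟨hk, h⟩ := h
      obtain rfl := Fin.castSucc_injective _ hk
      dsimp only at h h'; omega
    · obtain ⟨rfl, h⟩ := h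
      obtain ⟨hk, h'⟩ := h'
      rw [Fin.castSucc_injective _ hk]
  · rcases w with ⟨q, j⟩ | _
    swap
    · exact h.elim
    rcases w' with ⟨q', j'⟩ | _
    swap
    · exact h'.elim
    obtain ⟨rfl, h⟩ := h
    obtain ⟨rfl, h'⟩ := h'
    have h1 := hcod k rfl
    have : (j : ℕ) = j' := by dsimp only at h h'; omega
    rw [Fin.ext this]

theorem Link.left_unique {v v' w : Γ.Vertex} (h : Γ.Link v w) (h' : Γ.Link v' w)
    (hdom : ∀ k : Fin Γ.stack.length, (k : ℕ) = Γ.layerOf v → (Γ.stack.get k).piece.dom ≤ 1) :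
    v = v' := by
  rcases w with ⟨q, j⟩ | k
  · rcases v with ⟨p, i⟩ | k <;> rcases v' with ⟨p', i'⟩ | k'
    · obtain ⟨k, rfl, rfl, h⟩ := h
      obtain ⟨k', rfl, hk, h'⟩ := h'
      obtain rfl := Fin.succ_injective _ hk
      have : (i : ℕ) = i' := by dsimp only at h h'; omega
      rw [Fin.ext this]
    · obtain ⟨k, rfl, rfl, h⟩ := h
      obtain ⟨hk, h'⟩ := h'
      obtain rfl := Fin.succ_injective _ hk
      dsimp only at h h'; omega
    · obtain ⟨k', rfl, rfl, h'⟩ := h'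
      obtain ⟨hk, h⟩ := h
      obtain rfl := Fin.succ_injective _ hk
      dsimp only at h h'; omega
    · obtain ⟨rfl, h⟩ := h
      obtain ⟨hk, h'⟩ := h'
      rw [Fin.succ_injective _ hk]
  · rcases v with ⟨p, i⟩ | _
    swap
    · exact h.elim
    rcases v' with ⟨p', i'⟩ | _
    swap
    · exact h'.elim
    obtain ⟨rfl, h⟩ := h
    obtain ⟨rfl, h'⟩ := h'
    have h1 := hdom k (by simp [layerOf])
    have : (i : ℕ) = i' := by dsimp only at h h'; omega
    rw [Fin.ext this]

theorem exists_link_above (k : Fin Γ.stack.length)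
    (i : Fin (Γ.stack.width m (k.castSucc : Fin (Γ.stack.length + 1)))) :
    ∃ w, Γ.Link (.inl ⟨k.castSucc, i⟩) w := by
  have h1 := Γ.width_succ_add k
  have h2 := Γ.pos_add_dom_le k
  have hi : (i : ℕ) < Γ.stack.width m k := i.2
  by_cases h3 : (i : ℕ) < (Γ.stack.get k).pos
  · exact ⟨.inl ⟨k.succ, ⟨i, by simp only [Fin.val_succ]; omega⟩⟩, k, rfl, rfl, .inl ⟨h3, rfl⟩⟩
  by_cases h4 : (i : ℕ) < (Γ.stack.get k).pos + (Γ.stack.get k).piece.dom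
  · exact ⟨.inr k, rfl, by dsimp only; omega, h4⟩
  · exact ⟨.inl ⟨k.succ, ⟨i + (Γ.stack.get k).piece.cod - (Γ.stack.get k).piece.dom,
      by simp only [Fin.val_succ]; omega⟩⟩, k, rfl, rfl, .inr ⟨by dsimp only; omega,
      by dsimp only; omega⟩⟩

theorem exists_link_below (k : Fin Γ.stack.length)
    (j : Fin (Γ.stack.width m (k.succ : Fin (Γ.stack.length + 1)))) :
    ∃ v, Γ.Link v (.inl ⟨k.succ, j⟩) := by
  have h1 := Γ.width_succ_add k
  have h2 := Γ.pos_add_dom_le k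
  have hj : (j : ℕ) < Γ.stack.width m (k + 1) := j.2
  by_cases h3 : (j : ℕ) < (Γ.stack.get k).pos
  · exact ⟨.inl ⟨k.castSucc, ⟨j, by simp only [Fin.val_castSucc]; omega⟩⟩, k, rfl, rfl,
      .inl ⟨h3, rfl⟩⟩
  by_cases h4 : (j : ℕ) < (Γ.stack.get k).pos + (Γ.stack.get k).piece.cod
  · exact ⟨.inr k, rfl, by dsimp only; omega, h4⟩
  · exact ⟨.inl ⟨k.castSucc, ⟨j + (Γ.stack.get k).piece.dom - (Γ.stack.get k).piece.cod,
      by simp only [Fin.val_castSucc]; omega⟩⟩, k, rfl, rfl, .inr ⟨by dsimp only; omega,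
      by dsimp only; omega⟩⟩

theorem exists_link_above_piece (k : Fin Γ.stack.length) (h : (Γ.stack.get k).piece.cod ≠ 0) :
    ∃ w, Γ.Link (.inr k) w := by
  have h1 := Γ.width_succ_add k
  have h2 := Γ.pos_add_dom_le k
  exact ⟨.inl ⟨k.succ, ⟨(Γ.stack.get k).pos, by simp only [Fin.val_succ]; omega⟩⟩, rfl, le_rfl,
    by dsimp only; omega⟩

theorem exists_link_below_piece (k : Fin Γ.stack.length) (h : (Γ.stack.get k).piece.dom ≠ 0) :
    ∃ v, Γ.Link v (.inr k) := by
  have h2 := Γ.pos_add_dom_le k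
  exact ⟨.inl ⟨k.castSucc, ⟨(Γ.stack.get k).pos, by simp only [Fin.val_castSucc]; omega⟩⟩, rfl,
    le_rfl, by dsimp only; omega⟩

variable (Γ)

/-- The first `K` layers only have lower pieces, the other ones only have upper pieces. -/
def Waist (K : ℕ) : Prop :=
  K ≤ Γ.stack.length ∧ ∀ k : Fin Γ.stack.length,
    ((k : ℕ) < K → IsLower (Γ.stack.get k).piece) ∧ (K ≤ (k : ℕ) → IsUpper (Γ.stack.get k).piece)

/-- One step along an edge towards height `K`. -/
def Par (K : ℕ) (v w : Γ.Vertex) : Prop :=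
  (Γ.Link v w ∧ Γ.layerOf v < K) ∨ (Γ.Link w v ∧ K ≤ Γ.layerOf w)

/-- Twice the distance of a point from height `K`. -/
def parRank (K : ℕ) (v : Γ.Vertex) : ℕ :=
  (Γ.twiceHeight v - 2 * K) + (2 * K - Γ.twiceHeight v)

/-- The points without a step towards height `K`: the strands at that height, the dots and maxima
below it, and the dots and minima above it. -/
def IsRoot (K : ℕ) : Γ.Vertex → Prop
  | .inl p => (p.1 : ℕ) = K
  | .inr k => ((k : ℕ) < K ∧ (Γ.stack.get k).piece.cod = 0) ∨
      (K ≤ (k : ℕ) ∧ (Γ.stack.get k).piece.dom = 0)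

variable {Γ} {K : ℕ}

theorem Link.ne {v w : Γ.Vertex} (h : Γ.Link v w) : v ≠ w := by
  rintro rfl
  exact absurd h.height.2.1 (lt_irrefl _)

theorem Par.adj {v w : Γ.Vertex} (h : Γ.Par K v w) : Γ.toGraph.Adj v w := by
  rcases h with ⟨h, -⟩ | ⟨h, -⟩
  · exact (SimpleGraph.fromRel_adj _ _ _).2 ⟨h.ne, .inl h⟩
  · exact (SimpleGraph.fromRel_adj _ _ _).2 ⟨h.ne.symm, .inr h⟩

theorem par_or_par_of_adj {v w : Γ.Vertex} (h : Γ.toGraph.Adj v w) :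
    Γ.Par K v w ∨ Γ.Par K w v := by
  rcases ((SimpleGraph.fromRel_adj _ _ _).1 h).2 with h | h
  · rcases lt_or_ge (Γ.layerOf v) K with h' | h'
    · exact .inl (.inl ⟨h, h'⟩)
    · exact .inr (.inr ⟨h, h'⟩)
  · rcases lt_or_ge (Γ.layerOf w) K with h' | h'
    · exact .inr (.inl ⟨h, h'⟩)
    · exact .inl (.inr ⟨h, h'⟩)

theorem Par.rank_lt {v w : Γ.Vertex} (h : Γ.Par K v w) : Γ.parRank K w < Γ.parRank K v := by
  rcases h with ⟨h, h'⟩ | ⟨h, h'⟩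
  · have := h.height; simp only [parRank]; omega
  · have := h.height; simp only [parRank]; omega

theorem Waist.par_unique (hK : Γ.Waist K) {v w w' : Γ.Vertex} (h : Γ.Par K v w)
    (h' : Γ.Par K v w') : w = w' := by
  rcases h with ⟨h, h1⟩ | ⟨h, h1⟩ <;> rcases h' with ⟨h', h2⟩ | ⟨h', h2⟩
  · exact h.right_unique h' fun k hk => ((hK.2 k).1 (by omega)).cod_le_one
  · have := h'.layerOf_le; omega
  · have := h.layerOf_le; omega
  · exact h.left_unique h' fun k hk => ((hK.2 k).2 (by omega)).dom_le_one

theorem Waist.isAcyclic (hK : Γ.Waist K) : Γ.toGraph.IsAcyclic :=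
  isAcyclic_of_parent (fun _ _ => par_or_par_of_adj) (fun _ _ => Par.rank_lt)
    (fun _ _ _ => hK.par_unique)

theorem isRoot_iff (hK : K ≤ Γ.stack.length) {v : Γ.Vertex} :
    Γ.IsRoot K v ↔ ∀ w, ¬ Γ.Par K v w := by
  rcases v with ⟨p, i⟩ | k
  · simp only [IsRoot]
    constructor
    · rintro hp (⟨q, j⟩ | k) (⟨h, h'⟩ | ⟨h, h'⟩)
      · simp only [layerOf] at h'; omega
      · obtain ⟨k, rfl, rfl, -⟩ := h
        simp [layerOf] at h' hp; omega
      · simp only [layerOf] at h'; omega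
      · obtain ⟨rfl, -⟩ := h
        simp [layerOf] at h' hp; omega
    · intro h
      by_contra hp
      rcases lt_or_gt_of_ne hp with hp | hp
      · obtain ⟨k, rfl⟩ : ∃ k : Fin Γ.stack.length, p = k.castSucc := ⟨⟨p, by omega⟩, rfl⟩
        obtain ⟨w, hw⟩ := exists_link_above k i
        exact h w (.inl ⟨hw, hp⟩)
      · obtain ⟨k, rfl⟩ : ∃ k : Fin Γ.stack.length, p = k.succ :=
          ⟨⟨p - 1, by omega⟩, Fin.ext (by simp only [Fin.val_succ]; omega)⟩
        obtain ⟨w, hw⟩ := exists_link_below k i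
        refine h w (.inr ⟨hw, ?_⟩)
        have := hw.height
        simp only [twiceHeight] at this
        omega
  · simp only [IsRoot]
    constructor
    · rintro hk (⟨q, j⟩ | k) (⟨h, h'⟩ | ⟨h, h'⟩)
      · obtain ⟨rfl, h⟩ := h
        simp only [layerOf] at h'; omega
      · obtain ⟨rfl, h⟩ := h
        simp only [layerOf, Fin.val_castSucc] at h'; omega
      · exact h.elim
      · exact h.elim
    · intro h
      rcases lt_or_ge (k : ℕ) K with hk | hk
      · refine .inl ⟨hk, ?_⟩
        by_contra h0
        obtain ⟨w, hw⟩ := exists_link_above_piece k h0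
        exact h w (.inl ⟨hw, hk⟩)
      · refine .inr ⟨hk, ?_⟩
        by_contra h0
        obtain ⟨w, hw⟩ := exists_link_below_piece k h0
        refine h w (.inr ⟨hw, ?_⟩)
        have := hw.height
        simp only [twiceHeight] at this
        omega

end StripGraph

/-! ### The Euler characteristic of a component -/

theorem count_ofFn {α : Type*} [DecidableEq α] {w : ℕ} (g : Fin w → α) (C : α) :
    (List.ofFn g).count C = ∑ i, if g i = C then 1 else 0 := by
  induction w with
  | zero => simp
  | succ w ih =>
    rw [List.ofFn_succ, List.count_cons, ih, Fin.sum_univ_succ, Nat.add_comm]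
    simp only [beq_iff_eq]

theorem natCard_subtype_eq_sum {ι : Type*} [Fintype ι] (p : ι → Prop) [DecidablePred p] :
    Nat.card {i // p i} = ∑ i, if p i then 1 else 0 := by
  rw [Nat.card_eq_fintype_card, Fintype.card_subtype, Finset.card_filter]

namespace StripGraph
variable {m n : ℕ} {Γ : StripGraph m n} {K : ℕ}

open Classical in
/-- The number of strands of a component at height `k`. -/
noncomputable def numStrands (Γ : StripGraph m n) (C : Γ.Component)
    (k : Fin (Γ.stack.length + 1)) : ℕ :=
  (Γ.crossSection Γ.toGraph.connectedComponentMk k).count C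

open Classical in
theorem numBoundary_eq (C : Γ.Component) :
    Γ.numBoundary C = Γ.numStrands C 0 + Γ.numStrands C (Fin.last _) := by
  rw [numBoundary, natCard_subtype_eq_sum, Fintype.sum_sum_type, numStrands, numStrands,
    crossSection, crossSection, count_ofFn, count_ofFn]
  congr 1
  exact (finCongr (Stack.width_length Γ.fits).symm).sum_comp
    (fun i => if Γ.toGraph.connectedComponentMk (.inl ⟨Fin.last _, i⟩) = C then 1 else 0)

open Classical in
theorem numStrands_succ (C : Γ.Component) (k : Fin Γ.stack.length) :
    Γ.numStrands C k.succ + (if Γ.toGraph.connectedComponentMk (.inr k) = C then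
        (Γ.stack.get k).piece.dom else 0) =
      Γ.numStrands C k.castSucc + (if Γ.toGraph.connectedComponentMk (.inr k) = C then
        (Γ.stack.get k).piece.cod else 0) := by
  obtain ⟨u, v, -, h1, h2⟩ := crossSection_succ (Γ := Γ)
    (f := Γ.toGraph.connectedComponentMk) (fun v w => Γ.component_eq_of_link) k
  simp only [numStrands, h1, h2, List.count_append, List.count_replicate, beq_iff_eq]
  omega

theorem sum_fin_telescope {L : ℕ} (g : Fin (L + 1) → ℤ) :
    ∑ k : Fin L, (g k.succ - g k.castSucc) = g (Fin.last L) - g 0 := by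
  rw [Finset.sum_sub_distrib]
  have h1 := Fin.sum_univ_succ g
  have h2 := Fin.sum_univ_castSucc g
  linarith

open Classical in
/-- Every component has exactly one root. -/
theorem Waist.card_roots (hK : Γ.Waist K) (C : Γ.Component) :
    (∑ v : Γ.Vertex, if Γ.toGraph.connectedComponentMk v = C ∧ Γ.IsRoot K v then 1 else 0) = 1 := by
  obtain ⟨v, rfl⟩ := C.exists_rep
  obtain ⟨r, hr, hvr⟩ := exists_root_reachable (G := Γ.toGraph) (fun _ _ => Par.adj)
    (fun _ _ => Par.rank_lt (K := K)) v
  rw [Finset.sum_eq_single r]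
  · rw [if_pos ⟨SimpleGraph.ConnectedComponent.eq.2 hvr.symm, (isRoot_iff hK.1).2 hr⟩]
  · intro w _ hw
    refine if_neg fun h => hw ?_
    exact root_unique (G := Γ.toGraph) (fun _ _ => par_or_par_of_adj)
      (fun _ _ _ => hK.par_unique) hr ((isRoot_iff hK.1).1 h.2)
      (hvr.symm.trans (SimpleGraph.ConnectedComponent.eq.1 h.1).symm)
  · simp

open Classical in
theorem Waist.numStrands_add_sum (hK : Γ.Waist K) (C : Γ.Component) :
    Γ.numStrands C ⟨K, Nat.lt_succ_of_le hK.1⟩ + (∑ k : Fin Γ.stack.length,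
      if Γ.toGraph.connectedComponentMk (.inr k) = C ∧ Γ.IsRoot K (.inr k) then 1 else 0) = 1 := by
  refine Eq.trans ?_ (hK.card_roots C)
  rw [Fintype.sum_sum_type, Fintype.sum_sigma]
  congr 1
  rw [Finset.sum_eq_single ⟨K, Nat.lt_succ_of_le hK.1⟩, numStrands, crossSection, count_ofFn]
  · simp [IsRoot]
  · intro k _ hk
    refine Finset.sum_eq_zero fun i _ => if_neg fun h => hk (Fin.ext h.2)
  · simp

open Classical in
/-- The Euler characteristic of a component, which is a tree. -/
theorem Waist.numTrivalent_add_two (hK : Γ.Waist K) (C : Γ.Component) :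
    Γ.numTrivalent C + 2 = Γ.numBoundary C + Γ.numDots C := by
  have h1 := hK.numStrands_add_sum C
  -- Strands are counted going away from the waist, hence downwards below it. Replacing the number
  -- `s k` of strands at a height `k ≤ K` by `2 * s K - s k` makes this a single telescoping sum.
  have h2 := sum_fin_telescope fun k : Fin (Γ.stack.length + 1) =>
    if (k : ℕ) ≤ K then 2 * (Γ.numStrands C ⟨K, Nat.lt_succ_of_le hK.1⟩ : ℤ) - Γ.numStrands C k
    else Γ.numStrands C k
  have hlast : (if ((Fin.last Γ.stack.length : Fin _) : ℕ) ≤ K then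
      2 * (Γ.numStrands C ⟨K, Nat.lt_succ_of_le hK.1⟩ : ℤ) - Γ.numStrands C (Fin.last _)
      else Γ.numStrands C (Fin.last _)) = Γ.numStrands C (Fin.last _) := by
    split_ifs with h
    · have : (⟨K, Nat.lt_succ_of_le hK.1⟩ : Fin (Γ.stack.length + 1)) = Fin.last _ :=
        Fin.ext (le_antisymm hK.1 h)
      rw [this]; ring
    · rfl
  rw [hlast, if_pos (by simp)] at h2
  -- The contribution of a single layer.
  have h3 : ∀ k : Fin Γ.stack.length,
      ((if (k.succ : ℕ) ≤ K then
          2 * (Γ.numStrands C ⟨K, Nat.lt_succ_of_le hK.1⟩ : ℤ) - Γ.numStrands C k.succ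
        else Γ.numStrands C k.succ) -
      (if (k.castSucc : ℕ) ≤ K then
          2 * (Γ.numStrands C ⟨K, Nat.lt_succ_of_le hK.1⟩ : ℤ) - Γ.numStrands C k.castSucc
        else Γ.numStrands C k.castSucc)) =
      2 * (if Γ.toGraph.connectedComponentMk (.inr k) = C ∧ Γ.IsRoot K (.inr k) then 1 else 0) +
      (if (Γ.stack.get k).piece.IsTrivalent ∧ Γ.toGraph.connectedComponentMk (.inr k) = C
        then 1 else 0) -
      (if (Γ.stack.get k).piece.IsDot ∧ Γ.toGraph.connectedComponentMk (.inr k) = C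
        then 1 else 0) := by
    intro k
    have hs := Γ.numStrands_succ C k
    have hmid : (k : ℕ) = K → k.castSucc = (⟨K, Nat.lt_succ_of_le hK.1⟩ : Fin _) :=
      fun h => Fin.ext h
    by_cases hC : Γ.toGraph.connectedComponentMk (.inr k) = C
    · simp only [hC, if_true, true_and, and_true] at hs ⊢
      rcases lt_or_ge (k : ℕ) K with hk | hk
      · rw [if_pos (by simp only [Fin.val_succ]; omega),
          if_pos (by simp only [Fin.val_castSucc]; omega)]
        rcases (hK.2 k).1 hk with h | h | h <;>
          simp [-List.get_eq_getElem, h, IsRoot, IsDot, IsTrivalent, dom, cod, hk] at hs ⊢ <;> omega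
      · rw [if_neg (by simp only [Fin.val_succ]; omega)]
        have e : (if ((k.castSucc : Fin _) : ℕ) ≤ K then
            2 * (Γ.numStrands C ⟨K, Nat.lt_succ_of_le hK.1⟩ : ℤ) - Γ.numStrands C k.castSucc
            else Γ.numStrands C k.castSucc) = Γ.numStrands C k.castSucc := by
          split_ifs with h
          · rw [hmid (le_antisymm h hk)]; ring
          · rfl
        rw [e]
        rcases (hK.2 k).2 hk with h | h | h <;>
          simp [-List.get_eq_getElem, h, IsRoot, IsDot, IsTrivalent, dom, cod, hk,
            not_lt.2 hk] at hs ⊢ <;>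
          omega
    · simp only [hC, if_false, false_and, and_false] at hs ⊢
      rcases lt_or_ge (k : ℕ) K with hk | hk
      · rw [if_pos (by simp only [Fin.val_succ]; omega),
          if_pos (by simp only [Fin.val_castSucc]; omega)]
        omega
      · rw [if_neg (by simp only [Fin.val_succ]; omega)]
        split_ifs with h
        · rw [← hmid (le_antisymm h hk)]; omega
        · omega
  simp only [h3] at h2
  rw [numTrivalent, numDots, natCard_subtype_eq_sum, natCard_subtype_eq_sum, numBoundary_eq]
  simp only [Finset.sum_sub_distrib, Finset.sum_add_distrib, ← Finset.mul_sum] at h2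
  zify at h1 ⊢
  linarith

/-- If no component with a dot contains another vertex, the graph is a simple forest: the boundary
lines are then counted by the Euler characteristic. -/
theorem Waist.isSimpleForest (hK : Γ.Waist K) (hdots : ∀ k k' : Fin Γ.stack.length,
      (Γ.stack.get k).piece.IsDot → Γ.toGraph.Reachable (.inr k) (.inr k') → k' = k) :
    Γ.IsSimpleForest := by
  intro C
  refine ⟨hK.isAcyclic.isTree_connectedComponent C, ?_⟩
  have h := hK.numTrivalent_add_two C
  by_cases hd : ∃ k : Fin Γ.stack.length,
      (Γ.stack.get k).piece.IsDot ∧ Γ.toGraph.connectedComponentMk (.inr k) = C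
  · obtain ⟨k, hk, rfl⟩ := hd
    have h0 : Γ.numTrivalent (Γ.toGraph.connectedComponentMk (.inr k)) = 0 := by
      rw [numTrivalent, Nat.card_eq_zero]
      left
      refine ⟨fun ⟨k', ht, hk'⟩ => ?_⟩
      obtain rfl := hdots k k' hk (SimpleGraph.ConnectedComponent.eq.1 hk').symm
      rcases hk with hk | hk <;> rcases ht with ht | ht <;>
        exact absurd (hk.symm.trans ht) (by simp)
    have h1 : Γ.numDots (Γ.toGraph.connectedComponentMk (.inr k)) = 1 := by
      rw [numDots, Nat.card_eq_one_iff_unique]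
      exact ⟨⟨fun ⟨a, ha, ha'⟩ ⟨b, hb, hb'⟩ => Subtype.ext
        ((hdots k a hk (SimpleGraph.ConnectedComponent.eq.1 ha').symm).trans
        (hdots k b hk (SimpleGraph.ConnectedComponent.eq.1 hb').symm).symm)⟩, ⟨k, hk, rfl⟩⟩
    exact .inr ⟨by omega, h0, h1⟩
  · have h0 : Γ.numDots C = 0 := by
      rw [numDots, Nat.card_eq_zero]
      left
      exact ⟨fun ⟨k, hk⟩ => hd ⟨k, hk⟩⟩
    exact .inl ⟨by omega, by omega, h0⟩

end StripGraph

/-! ### Components with a dot -/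

namespace StripGraph
variable {m n : ℕ} {Γ : StripGraph m n} {K : ℕ}

/-- If all layers up to the one of an upper dot are such dots as well, then the component of the dot
is the strand that hangs down from it. -/
theorem Waist.eq_of_reachable_endDot (hK : Γ.Waist K) {k k' : Fin Γ.stack.length} (hk : (k : ℕ) < K)
    (hd : ∀ j : Fin Γ.stack.length, j ≤ k → (Γ.stack.get j).piece = endDot)
    (h : Γ.toGraph.Reachable (.inr k) (.inr k')) : k' = k := by
  have hroot : Γ.IsRoot K (.inr k) := .inl ⟨hk, by rw [hd k le_rfl]; rfl⟩
  have hr := reflTransGen_parent_of_reachable (fun _ _ => par_or_par_of_adj)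
    (fun _ _ _ => hK.par_unique) ((isRoot_iff hK.1).1 hroot) h
  have key : ∀ v, Relation.ReflTransGen (Γ.Par K) v (.inr k) →
      v = .inr k ∨ ∃ p i, v = .inl ⟨p, i⟩ ∧ (p : ℕ) ≤ k := by
    intro v hv
    induction hv using Relation.ReflTransGen.head_induction_on with
    | refl => exact .inl rfl
    | head hvw _ ih =>
      rename_i v w _
      rcases ih with rfl | ⟨p, i, rfl, hp⟩
      · rcases hvw with ⟨hL, -⟩ | ⟨-, hL⟩
        · rcases v with ⟨q, j⟩ | k''
          · obtain ⟨rfl, -⟩ := hL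
            exact .inr ⟨_, _, rfl, by simp⟩
          · exact hL.elim
        · simp only [layerOf] at hL; omega
      · rcases hvw with ⟨hL, -⟩ | ⟨-, hL⟩
        · rcases v with ⟨q, j⟩ | k''
          · obtain ⟨l, rfl, rfl, -⟩ := hL
            simp only [Fin.val_succ] at hp
            exact .inr ⟨_, _, rfl, by simp only [Fin.val_castSucc]; omega⟩
          · obtain ⟨rfl, h1, h2⟩ := hL
            simp only [Fin.val_succ] at hp
            rw [hd k'' (Fin.le_def.2 (by omega))] at h2
            simp only [cod] at h1 h2
            omega
        · simp only [layerOf] at hL; omega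
  rcases key _ hr with h | ⟨p, i, h, -⟩
  · exact Sum.inr_injective h
  · exact absurd h (by simp)

/-- If all layers from the one of a lower dot on are such dots as well, then the component of the
dot is the strand that rises from it. -/
theorem Waist.eq_of_reachable_startDot (hK : Γ.Waist K) {k k' : Fin Γ.stack.length}
    (hk : K ≤ (k : ℕ))
    (hd : ∀ j : Fin Γ.stack.length, k ≤ j → (Γ.stack.get j).piece = startDot)
    (h : Γ.toGraph.Reachable (.inr k) (.inr k')) : k' = k := by
  have hroot : Γ.IsRoot K (.inr k) := .inr ⟨hk, by rw [hd k le_rfl]; rfl⟩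
  have hr := reflTransGen_parent_of_reachable (fun _ _ => par_or_par_of_adj)
    (fun _ _ _ => hK.par_unique) ((isRoot_iff hK.1).1 hroot) h
  have key : ∀ v, Relation.ReflTransGen (Γ.Par K) v (.inr k) →
      v = .inr k ∨ ∃ p i, v = .inl ⟨p, i⟩ ∧ (k : ℕ) < p := by
    intro v hv
    induction hv using Relation.ReflTransGen.head_induction_on with
    | refl => exact .inl rfl
    | head hvw _ ih =>
      rename_i v w _
      rcases ih with rfl | ⟨p, i, rfl, hp⟩
      · rcases hvw with ⟨hL, hL'⟩ | ⟨hL, -⟩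
        · have := hL.height
          simp only [twiceHeight] at this; omega
        · rcases v with ⟨q, j⟩ | k''
          · obtain ⟨rfl, -⟩ := hL
            exact .inr ⟨_, _, rfl, by simp⟩
          · exact hL.elim
      · rcases hvw with ⟨hL, hL'⟩ | ⟨hL, -⟩
        · have := hL.height
          simp only [twiceHeight] at this; omega
        · rcases v with ⟨q, j⟩ | k''
          · obtain ⟨l, rfl, rfl, -⟩ := hL
            simp only [Fin.val_castSucc] at hp
            exact .inr ⟨_, _, rfl, by simp only [Fin.val_succ]; omega⟩
          · obtain ⟨rfl, h1, h2⟩ := hL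
            simp only [Fin.val_castSucc] at hp
            rw [hd k'' (Fin.le_def.2 (by omega))] at h2
            simp only [dom] at h1 h2
            omega
  rcases key _ hr with h | ⟨p, i, h, -⟩
  · exact Sum.inr_injective h
  · exact absurd h (by simp)

theorem waist_of_append {A B : Stack} (h : Γ.stack = A ++ B) (hA : A.All IsLower)
    (hB : B.All IsUpper) : Γ.Waist A.length := by
  refine ⟨by simp [h], fun k => ⟨fun hk => ?_, fun hk => ?_⟩⟩
  · refine hA _ ?_
    have : Γ.stack.get k = A[(k : ℕ)] := by
      simp only [List.get_eq_getElem, h]; exact List.getElem_append_left hk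
    rw [this]; exact List.getElem_mem _
  · refine hB _ ?_
    have hk' : (k : ℕ) - A.length < B.length := by
      have := k.2; simp only [h, List.length_append] at this; omega
    have : Γ.stack.get k = B[(k : ℕ) - A.length] := by
      simp only [List.get_eq_getElem, h]; exact List.getElem_append_right hk
    rw [this]; exact List.getElem_mem _

/-- Only dots lie between a dot and the boundary line that it faces, so its component is one
edge. -/
theorem isSimpleForest_of_stack {E M W T : Stack} (h : Γ.stack = (E ++ M) ++ (W ++ T))
    (hE : E.All (· = endDot)) (hM : M.All fun g => g = merge ∨ g = cap)
    (hW : W.All fun g => g = split ∨ g = cup) (hT : T.All (· = startDot)) :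
    Γ.IsSimpleForest := by
  have hK : Γ.Waist (E ++ M).length := by
    refine waist_of_append h (Stack.all_append.2 ⟨fun l hl => .inl (hE l hl), fun l hl => ?_⟩)
      (Stack.all_append.2 ⟨fun l hl => ?_, fun l hl => .inl (hT l hl)⟩)
    · exact .inr (hM l hl)
    · exact .inr (hW l hl)
  have hget : ∀ (s : Stack) (i : ℕ) (hi : i < s.length) (P : Piece → Prop), s.All P →
      P s[i].piece := fun s i hi P hs => hs _ (List.getElem_mem _)
  have hpiece : ∀ k : Fin Γ.stack.length,
      ((k : ℕ) < E.length ∧ (Γ.stack.get k).piece = endDot) ∨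
      ((k : ℕ) ≥ (E ++ M ++ W).length ∧ (Γ.stack.get k).piece = startDot) ∨
      (E.length ≤ (k : ℕ) ∧ (k : ℕ) < (E ++ M ++ W).length ∧ ¬ (Γ.stack.get k).piece.IsDot) := by
    intro k
    have hk := k.2
    simp only [List.get_eq_getElem, h, List.getElem_append, List.length_append] at hk ⊢
    split_ifs with h1 h2 h3
    · exact .inl ⟨h2, hget _ _ _ _ hE⟩
    · refine .inr (.inr ⟨by omega, by omega, ?_⟩)
      rcases hget M ((k : ℕ) - E.length) (by omega) _ hM with h | h <;> simp [h, IsDot]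
    · refine .inr (.inr ⟨by omega, by omega, ?_⟩)
      rcases hget W ((k : ℕ) - (E.length + M.length)) (by omega) _ hW with h | h <;>
        simp [h, IsDot]
    · exact .inr (.inl ⟨by omega, hget _ _ _ _ hT⟩)
  refine hK.isSimpleForest fun k k' hk hr => ?_
  rcases hpiece k with ⟨h1, h2⟩ | ⟨h1, h2⟩ | ⟨-, -, h⟩
  · refine hK.eq_of_reachable_endDot (by simp; omega) (fun j hj => ?_) hr
    have hj' := Fin.le_def.1 hj
    rcases hpiece j with ⟨-, h⟩ | ⟨h3, -⟩ | ⟨h3, -⟩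
    · exact h
    · simp at h3; omega
    · omega
  · refine hK.eq_of_reachable_startDot (by simp at h1 ⊢; omega) (fun j hj => ?_) hr
    have hj' := Fin.le_def.1 hj
    rcases hpiece j with ⟨h3, -⟩ | ⟨-, h⟩ | ⟨-, h3, -⟩
    · simp at h1; omega
    · exact h
    · omega
  · exact absurd hk h

/-- Every point is connected to a root, so a graph with only one root is connected. -/
theorem Waist.connected [Nonempty Γ.Vertex] (hK : Γ.Waist K)
    (h : ∀ v w : Γ.Vertex, Γ.IsRoot K v → Γ.IsRoot K w → v = w) : Γ.toGraph.Connected := by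
  rw [SimpleGraph.connected_iff]
  refine ⟨fun v w => ?_, ‹_›⟩
  have hex := exists_root_reachable (G := Γ.toGraph) (fun _ _ => Par.adj)
    (fun _ _ => Par.rank_lt (K := K))
  obtain ⟨r, hr, hvr⟩ := hex v
  obtain ⟨r', hr', hwr⟩ := hex w
  rw [h r r' ((isRoot_iff hK.1).2 hr) ((isRoot_iff hK.1).2 hr')] at hvr
  exact hvr.trans hwr.symm

end StripGraph

/-! ### Connecting strands -/

section Connecting

theorem LocalStep.mono {m n : ℕ} {R R' : Stack → Stack → Prop} (hR : ∀ X Y, R X Y → R' X Y)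
    {Γ Γ' : StripGraph m n} (h : LocalStep R Γ Γ') : LocalStep R' Γ Γ' := by
  obtain ⟨lo, up, X, Y, a, h, h1, h2⟩ := h
  exact ⟨lo, up, X, Y, a, hR _ _ h, h1, h2⟩

theorem Red.toConnecting {s t : Stack} (h : Red BasicMove s t) : Red ConnectingOrBasicMove s t := by
  intro w n hn
  obtain ⟨h', hr⟩ := h w n hn
  refine ⟨h', Relation.ReflTransGen.mono (fun _ _ h => ?_) _ _ hr⟩
  exact h.imp_right fun h => h.imp_right fun h => h.mono fun _ _ h => .basic h

theorem Stack.Fits.unique {m n n' : ℕ} {s : Stack} (h : Stack.Fits m s n)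
    (h' : Stack.Fits m s n') : n = n' := by
  induction s generalizing m with
  | nil => exact h.symm.trans h'
  | cons l s ih => exact ih h.2 h'.2

theorem Stack.Fits.le_of_lower {m n : ℕ} {s : Stack} (h : Stack.Fits m s n)
    (hs : s.All IsLower) : n ≤ m := by
  induction s generalizing m with
  | nil => exact (show m = n from h).ge
  | cons l s ih =>
    rw [Stack.all_cons] at hs
    have h1 := ih h.2 hs.2
    have h2 := h.1
    rcases hs.1 with h3 | h3 | h3 <;> simp only [Layer.next, h3, dom, cod] at h1 h2 <;> omega

theorem redAt_connecting (w p : ℕ) (h : p + 2 ≤ w) :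
    RedAt ConnectingOrBasicMove w [] [⟨p, merge⟩, ⟨p, split⟩] := by
  have := RedAt.context (R := ConnectingOrBasicMove) (m := w) (a := p) (lower := []) (s := [])
    (t := [⟨0, merge⟩, ⟨0, split⟩]) [] ?_
  · exact this
  · intro k hk _ _
    obtain rfl : w = k := hk
    refine ⟨w - p, by omega, RedAt.of_step (fun n hn => ?_) (.inr (.inr .connecting))⟩
    obtain rfl : w - p = n := hn
    simp only [Stack.Fits, Layer.next, dom, cod]
    omega

/-- An upper dot or a maximum with another strand beside it: connecting the two strands turns the
piece into merges. -/
theorem exists_redAt_merges_layer {w : ℕ} {l : Layer} (hl : IsLower l.piece)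
    (hw : l.pos + l.piece.dom ≤ w) (hn : 1 ≤ l.next w) :
    ∃ M : Stack, M.All (· = merge) ∧ RedAt ConnectingOrBasicMove w [l] M := by
  obtain ⟨q, g⟩ := l
  rcases hl with h | h | h <;> dsimp only at h <;> subst h <;>
    simp only [Layer.next, dom, cod] at hw hn
  · rcases q with _ | q
    · refine ⟨[⟨0, merge⟩], by simp [Stack.All], ?_⟩
      have h1 := (redAt_connecting w 0 (by omega)).append_right [⟨0, endDot⟩]
      exact h1.trans (red_counit_left.toConnecting.context [⟨0, merge⟩] [] 0 (by simp) w)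
    · refine ⟨[⟨q, merge⟩], by simp [Stack.All], ?_⟩
      have h1 := (redAt_connecting w q (by omega)).append_right [⟨q + 1, endDot⟩]
      exact h1.trans (red_counit_right.toConnecting.context [⟨q, merge⟩] [] q (by simp) w)
  · exact ⟨_, by simp [Stack.All], .refl _ _⟩
  · rcases q with _ | q
    · refine ⟨[⟨1, merge⟩, ⟨0, merge⟩], by simp [Stack.All], ?_⟩
      have h1 := (redAt_connecting w 1 (by omega)).append_right [⟨0, cap⟩]
      exact h1.trans (IsotopyRule.twistSplitLeft.red.context [⟨1, merge⟩] [] 0 (by simp) w)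
    · refine ⟨[⟨q, merge⟩, ⟨q, merge⟩], by simp [Stack.All], ?_⟩
      have h1 := (redAt_connecting w q (by omega)).append_right [⟨q + 1, cap⟩]
      exact h1.trans (IsotopyRule.twistSplitRight.red.context [⟨q, merge⟩] [] q (by simp) w)

/-- A lower dot or a minimum with another strand beside it: connecting the two turns the piece into
splits. -/
theorem exists_redAt_splits_layer {w : ℕ} {l : Layer} (hl : IsUpper l.piece)
    (hw : l.pos + l.piece.dom ≤ w) (h1w : 1 ≤ w) :
    ∃ S : Stack, S.All (· = split) ∧ RedAt ConnectingOrBasicMove w [l] S := by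
  obtain ⟨q, g⟩ := l
  rcases hl with h | h | h <;> dsimp only at h <;> subst h <;> simp only [dom] at hw
  · have h1 : ∀ p, p ≤ w - 1 → RedAt ConnectingOrBasicMove w [⟨q, startDot⟩]
        ([⟨q, startDot⟩] ++ [⟨p, merge⟩, ⟨p, split⟩]) := fun p hp =>
      RedAt.append_left (s := []) [⟨q, startDot⟩] fun k hk => redAt_connecting k p (by
        simp only [Stack.Fits, Layer.next, dom, cod] at hk; omega)
    rcases q with _ | q
    · refine ⟨[⟨0, split⟩], by simp [Stack.All], (h1 0 (by omega)).trans ?_⟩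
      exact red_unit_left.toConnecting.context [] [⟨0, split⟩] 0 (by simp) w
    · refine ⟨[⟨q, split⟩], by simp [Stack.All], (h1 q (by omega)).trans ?_⟩
      exact red_unit_right.toConnecting.context [] [⟨q, split⟩] q (by simp) w
  · exact ⟨_, by simp [Stack.All], .refl _ _⟩
  · have h1 : ∀ p, p ≤ w → RedAt ConnectingOrBasicMove w [⟨q, cup⟩]
        ([⟨q, cup⟩] ++ [⟨p, merge⟩, ⟨p, split⟩]) := fun p hp =>
      RedAt.append_left (s := []) [⟨q, cup⟩] fun k hk => redAt_connecting k p (by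
        simp only [Stack.Fits, Layer.next, dom, cod] at hk; omega)
    rcases q with _ | q
    · refine ⟨[⟨0, split⟩, ⟨1, split⟩], by simp [Stack.All], (h1 1 (by omega)).trans ?_⟩
      exact IsotopyRule.twistMergeLeft.red.context [] [⟨1, split⟩] 0 (by simp) w
    · refine ⟨[⟨q, split⟩, ⟨q, split⟩], by simp [Stack.All], (h1 q (by omega)).trans ?_⟩
      exact IsotopyRule.twistMergeRight.red.context [] [⟨q, split⟩] q (by simp) w

theorem exists_redAt_merges {m r : ℕ} {D : Stack} (hD : D.All IsLower) (hf : Stack.Fits m D r)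
    (hr : 1 ≤ r) : ∃ M : Stack, M.All (· = merge) ∧ RedAt ConnectingOrBasicMove m D M := by
  induction D generalizing m with
  | nil => exact ⟨[], .nil, .refl _ _⟩
  | cons l D ih =>
    rw [Stack.all_cons] at hD
    obtain ⟨M, hM, hr1⟩ := ih hD.2 hf.2
    have hle := Stack.Fits.le_of_lower hf.2 hD.2
    obtain ⟨M0, hM0, hr0⟩ := exists_redAt_merges_layer hD.1 hf.1 (by omega)
    obtain ⟨hf0, -⟩ := hr0 (l.next m) ⟨hf.1, rfl⟩
    refine ⟨M0 ++ M, Stack.all_append.2 ⟨hM0, hM⟩, (hr0.append_right D).trans ?_⟩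
    exact RedAt.append_left M0 fun k hk => hf0.unique hk ▸ hr1

theorem exists_redAt_splits {r n : ℕ} {U : Stack} (hU : U.All IsUpper) (hf : Stack.Fits r U n)
    (hr : 1 ≤ r) : ∃ S : Stack, S.All (· = split) ∧ RedAt ConnectingOrBasicMove r U S := by
  induction U generalizing r with
  | nil => exact ⟨[], .nil, .refl _ _⟩
  | cons l U ih =>
    rw [Stack.all_cons] at hU
    have h1 : 1 ≤ l.next r := by
      rcases hU.1 with h | h | h <;> simp only [Layer.next, h, dom, cod] <;> omega
    obtain ⟨S, hS, hr1⟩ := ih hU.2 hf.2 h1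
    obtain ⟨S0, hS0, hr0⟩ := exists_redAt_splits_layer hU.1 hf.1 hr
    obtain ⟨hf0, -⟩ := hr0 (l.next r) ⟨hf.1, rfl⟩
    refine ⟨S0 ++ S, Stack.all_append.2 ⟨hS0, hS⟩, (hr0.append_right U).trans ?_⟩
    exact RedAt.append_left S0 fun k hk => hf0.unique hk ▸ hr1

/-- Parallel strands are all connected to each other. -/
theorem exists_redAt_connected (w : ℕ) (hw : 1 ≤ w) : ∃ M S : Stack, M.All (· = merge) ∧
    S.All (· = split) ∧ Stack.Fits w M 1 ∧ RedAt ConnectingOrBasicMove w [] (M ++ S) := by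
  induction w, hw using Nat.le_induction with
  | base => exact ⟨[], [], .nil, .nil, rfl, .refl _ _⟩
  | succ w hw ih =>
    obtain ⟨M, S, hM, hS, hf, hr⟩ := ih
    have hfit : Stack.Fits (w + 1) [⟨0, merge⟩] w := by
      simp only [Stack.Fits, Layer.next, dom, cod]; omega
    refine ⟨[⟨0, merge⟩] ++ M, S ++ [⟨0, split⟩],
      Stack.all_append.2 ⟨by simp [Stack.All], hM⟩, Stack.all_append.2 ⟨hS, by simp [Stack.All]⟩,
      Stack.fits_append.2 ⟨_, hfit, hf⟩, (redAt_connecting (w + 1) 0 (by omega)).trans ?_⟩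
    have h1 : RedAt ConnectingOrBasicMove (w + 1) ([⟨0, merge⟩] ++ []) ([⟨0, merge⟩] ++ (M ++ S)) :=
      RedAt.append_left _ fun k hk => hfit.unique hk ▸ hr
    simpa using h1.append_right [⟨0, split⟩]

/-- The stacks that draw a tree: merges followed by splits, with one strand in between, or one of
the pictures that have no boundary point on the lower or on the upper line. -/
def TreeStack (m n : ℕ) (t : Stack) : Prop :=
  (m + n = 0 ∧ t = []) ∨
  (∃ M S : Stack, t = M ++ S ∧ M.All (· = merge) ∧ S.All (· = split) ∧ Stack.Fits m M 1) ∨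
  (n = 0 ∧ (t = [⟨0, endDot⟩] ∨ ∃ M : Stack, t = M ++ [⟨0, cap⟩] ∧ M.All (· = merge))) ∨
  (m = 0 ∧ (t = [⟨0, startDot⟩] ∨ ∃ S : Stack, t = ⟨0, cup⟩ :: S ∧ S.All (· = split)))

/-- A first layer on an empty strip is a dot or a minimum at the left end. -/
theorem Stack.Fits.zero_upper {u : Layer} {U : Stack} {n : ℕ} (hu : IsUpper u.piece)
    (h : Stack.Fits 0 (u :: U) n) : (u = ⟨0, startDot⟩ ∧ Stack.Fits 1 U n) ∨
      (u = ⟨0, cup⟩ ∧ Stack.Fits 2 U n) := by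
  obtain ⟨p, g⟩ := u
  obtain ⟨h1, h2⟩ := h
  rcases hu with h | h | h <;> dsimp only at h <;> subst h <;>
    simp only [Layer.next, dom, cod] at h1 h2
  · obtain rfl : p = 0 := by omega
    exact .inl ⟨rfl, h2⟩
  · omega
  · obtain rfl : p = 0 := by omega
    exact .inr ⟨rfl, h2⟩

theorem lower_to_zero {l : Layer} {k : ℕ} (hl : IsLower l.piece) (h : Stack.Fits k [l] 0) :
    (l = ⟨0, endDot⟩ ∧ k = 1) ∨ (l = ⟨0, cap⟩ ∧ k = 2) := by
  obtain ⟨p, g⟩ := l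
  obtain ⟨h1, h2⟩ := h
  simp only [Stack.Fits] at h2
  rcases hl with h | h | h <;> dsimp only at h <;> subst h <;>
    simp only [Layer.next, dom, cod] at h1 h2
  · obtain rfl : p = 0 := by omega
    exact .inl ⟨rfl, by omega⟩
  · omega
  · obtain rfl : p = 0 := by omega
    exact .inr ⟨rfl, by omega⟩

/-- A broken strand is mended: its two ends are drawn side by side, and connected there. -/
theorem red_endDot_startDot : Red ConnectingOrBasicMove [⟨0, endDot⟩, ⟨0, startDot⟩] [] := by
  intro w n hn
  have hw : 1 ≤ w := hn.1
  have h1 : RedAt ConnectingOrBasicMove w [⟨0, endDot⟩, ⟨0, startDot⟩]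
      [⟨1, startDot⟩, ⟨0, endDot⟩] := red_exchange_right 0 0 endDot startDot (by simp [cod]) w
  have h2 : RedAt ConnectingOrBasicMove w ([⟨1, startDot⟩] ++ [])
      ([⟨1, startDot⟩] ++ [⟨0, merge⟩, ⟨0, split⟩]) :=
    RedAt.append_left _ fun k hk => redAt_connecting k 0 (by
      simp only [Stack.Fits, Layer.next, dom, cod] at hk; omega)
  have h3 : Red ConnectingOrBasicMove [⟨1, startDot⟩, ⟨0, merge⟩, ⟨0, split⟩, ⟨0, endDot⟩]
      [⟨0, split⟩, ⟨0, endDot⟩] :=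
    red_unit_right.toConnecting.context [] [⟨0, split⟩, ⟨0, endDot⟩] 0 (by simp)
  exact (((h1.trans (h2.append_right [⟨0, endDot⟩])).trans (h3 w)).trans
    (red_counit_left.toConnecting w)) n hn

theorem red_endDot_cup : Red ConnectingOrBasicMove [⟨0, endDot⟩, ⟨0, cup⟩] [⟨0, split⟩] := by
  intro w n hn
  have hw : 1 ≤ w := hn.1
  have h1 : RedAt ConnectingOrBasicMove w [⟨0, endDot⟩, ⟨0, cup⟩]
      [⟨1, cup⟩, ⟨0, endDot⟩] := red_exchange_right 0 0 endDot cup (by simp [cod]) w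
  have h2 : RedAt ConnectingOrBasicMove w ([⟨1, cup⟩] ++ [])
      ([⟨1, cup⟩] ++ [⟨0, merge⟩, ⟨0, split⟩]) :=
    RedAt.append_left _ fun k hk => redAt_connecting k 0 (by
      simp only [Stack.Fits, Layer.next, dom, cod] at hk; omega)
  have h3 : Red ConnectingOrBasicMove [⟨1, cup⟩, ⟨0, merge⟩, ⟨0, split⟩, ⟨0, endDot⟩]
      [⟨0, split⟩, ⟨0, split⟩, ⟨0, endDot⟩] :=
    IsotopyRule.twistMergeRight.red.context [] [⟨0, split⟩, ⟨0, endDot⟩] 0 (by simp)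
  have h4 : Red ConnectingOrBasicMove [⟨0, split⟩, ⟨0, split⟩, ⟨0, endDot⟩] [⟨0, split⟩] :=
    red_counit_left.toConnecting.context [⟨0, split⟩] [] 0 (by simp)
  exact (((h1.trans (h2.append_right [⟨0, endDot⟩])).trans (h3 w)).trans (h4 w)) n hn

/-- If a strand is left at the waist, every dot and extremum has a strand beside it, and merges and
splits remain. Otherwise the highest lower piece and the lowest upper piece, if both exist, are
joined; if only one of the halves is there, its last dot or extremum is kept. -/
theorem exists_redAt_treeStack {m n : ℕ} (s : Stack) (hs : Stack.Fits m s n) :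
    ∃ t : Stack, TreeStack m n t ∧ RedAt ConnectingOrBasicMove m s t := by
  obtain ⟨D, U, hD, hU, hr⟩ := exists_red_lower_upper s
  replace hr := hr.toConnecting m
  obtain ⟨hf, -⟩ := hr n hs
  obtain ⟨r, hfD, hfU⟩ := Stack.fits_append.1 hf
  rcases Nat.eq_zero_or_pos r with rfl | hr1
  swap
  -- A strand is left at the waist.
  · obtain ⟨M, hM, hrM⟩ := exists_redAt_merges hD hfD hr1
    obtain ⟨S, hS, hrS⟩ := exists_redAt_splits hU hfU hr1
    obtain ⟨M', S', hM', hS', hf', hr'⟩ := exists_redAt_connected r hr1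
    obtain ⟨hfM, -⟩ := hrM r hfD
    refine ⟨(M ++ M') ++ (S' ++ S), .inr (.inl ⟨_, _, rfl, Stack.all_append.2 ⟨hM, hM'⟩,
      Stack.all_append.2 ⟨hS', hS⟩, Stack.fits_append.2 ⟨_, hfM, hf'⟩⟩), hr.trans ?_⟩
    refine (hrM.append_right U).trans ?_
    have h1 : RedAt ConnectingOrBasicMove m (M ++ U) (M ++ S) :=
      RedAt.append_left M fun k hk => hfM.unique hk ▸ hrS
    have h2 : RedAt ConnectingOrBasicMove m (M ++ []) (M ++ (M' ++ S')) :=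
      RedAt.append_left M fun k hk => hfM.unique hk ▸ hr'
    simpa using h1.trans (by simpa using h2.append_right S)
  rcases List.eq_nil_or_concat D with rfl | ⟨D0, l, rfl⟩
  · obtain rfl : m = 0 := hfD
    rw [List.nil_append] at hr
    rcases U with _ | ⟨u, U⟩
    · obtain rfl : 0 = n := hfU
      exact ⟨[], .inl ⟨rfl, rfl⟩, hr⟩
    rw [Stack.all_cons] at hU
    rcases hfU.zero_upper hU.1 with ⟨rfl, hfU'⟩ | ⟨rfl, hfU'⟩
    · obtain ⟨S, hS, hrS⟩ := exists_redAt_splits hU.2 hfU' le_rfl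
      have h1 : RedAt ConnectingOrBasicMove 0 ([⟨0, startDot⟩] ++ U) ([⟨0, startDot⟩] ++ S) :=
        RedAt.append_left _ fun k hk =>
          (show Stack.Fits 0 [⟨0, startDot⟩] 1 from ⟨le_rfl, rfl⟩).unique hk ▸ hrS
      rcases S with _ | ⟨⟨p, g⟩, S⟩
      · exact ⟨[⟨0, startDot⟩], .inr (.inr (.inr ⟨rfl, .inl rfl⟩)), hr.trans h1⟩
      · rw [Stack.all_cons] at hS
        obtain rfl : g = split := hS.1
        obtain ⟨hfS, -⟩ := hrS n hfU'
        have h2 : p + 1 ≤ 1 := hfS.1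
        obtain rfl : p = 0 := by omega
        refine ⟨⟨0, cup⟩ :: S, .inr (.inr (.inr ⟨rfl, .inr ⟨S, rfl, hS.2⟩⟩)),
          (hr.trans h1).trans ?_⟩
        exact (red_startDot_split.toConnecting.append_right S) 0
    · obtain ⟨S, hS, hrS⟩ := exists_redAt_splits hU.2 hfU' (by omega)
      refine ⟨⟨0, cup⟩ :: S, .inr (.inr (.inr ⟨rfl, .inr ⟨S, rfl, hS⟩⟩)), hr.trans ?_⟩
      exact RedAt.append_left [⟨0, cup⟩] fun k hk =>
          (show Stack.Fits 0 [⟨0, cup⟩] 2 from ⟨le_rfl, rfl⟩).unique hk ▸ hrS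
  · rw [List.concat_eq_append] at hr hD hfD
    obtain ⟨k, hfD0, hfl⟩ := Stack.fits_append.1 hfD
    rw [Stack.all_append, Stack.all_cons] at hD
    have hl := lower_to_zero hD.2.1 hfl
    obtain ⟨M, hM, hrM⟩ := exists_redAt_merges hD.1 hfD0 (by omega)
    obtain ⟨hfM, -⟩ := hrM k hfD0
    have hr2 : RedAt ConnectingOrBasicMove m s (M ++ ([l] ++ U)) :=
      hr.trans (by simpa using hrM.append_right ([l] ++ U))
    rcases U with _ | ⟨u, U⟩
    · obtain rfl : 0 = n := hfU
      rw [List.append_nil] at hr2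
      rcases hl with ⟨rfl, rfl⟩ | ⟨rfl, rfl⟩
      · rcases List.eq_nil_or_concat M with rfl | ⟨M, ⟨p, g⟩, rfl⟩
        · exact ⟨_, .inr (.inr (.inl ⟨rfl, .inl rfl⟩)), hr2⟩
        · rw [List.concat_eq_append] at hfM hr2 hM
          rw [Stack.all_append, Stack.all_cons] at hM
          obtain rfl : g = merge := hM.2.1
          obtain ⟨j, -, hj⟩ := Stack.fits_append.1 hfM
          simp only [Stack.Fits, Layer.next, dom, cod] at hj
          obtain rfl : p = 0 := by omega
          refine ⟨_, .inr (.inr (.inl ⟨rfl, .inr ⟨M, rfl, hM.1⟩⟩)), hr2.trans ?_⟩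
          simpa using (BasicMove.dotContraction.red.toConnecting.append_left M) m
      · exact ⟨_, .inr (.inr (.inl ⟨rfl, .inr ⟨M, rfl, hM⟩⟩)), hr2⟩
    · rw [Stack.all_cons] at hU
      obtain ⟨A, hA, hfA, hrA⟩ : ∃ A : Stack, A.All (· = merge) ∧ Stack.Fits k A 1 ∧
          Red ConnectingOrBasicMove [l] (A ++ [⟨0, endDot⟩]) := by
        rcases hl with ⟨rfl, rfl⟩ | ⟨rfl, rfl⟩
        · exact ⟨[], .nil, rfl, .refl _⟩
        · exact ⟨[⟨0, merge⟩], by simp [Stack.All], ⟨le_rfl, rfl⟩,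
            BasicMove.dotExpansion.red.toConnecting⟩
      obtain ⟨Z, j, hZ, hj, hfZ, hfU', hrZ⟩ : ∃ (Z : Stack) (j : ℕ), Z.All (· = split) ∧ 1 ≤ j ∧
          Stack.Fits 1 Z j ∧ Stack.Fits j U n ∧
          Red ConnectingOrBasicMove [⟨0, endDot⟩, u] Z := by
        rcases hfU.zero_upper hU.1 with ⟨rfl, hfU'⟩ | ⟨rfl, hfU'⟩
        · exact ⟨[], 1, .nil, le_rfl, rfl, hfU', red_endDot_startDot⟩
        · exact ⟨[⟨0, split⟩], 2, by simp [Stack.All], by omega, ⟨le_rfl, rfl⟩, hfU',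
            red_endDot_cup⟩
      obtain ⟨S, hS, hrS⟩ := exists_redAt_splits hU.2 hfU' hj
      have hfMA : Stack.Fits m (M ++ A) 1 := Stack.fits_append.2 ⟨_, hfM, hfA⟩
      refine ⟨(M ++ A) ++ (Z ++ S), .inr (.inl ⟨_, _, rfl, Stack.all_append.2 ⟨hM, hA⟩,
        Stack.all_append.2 ⟨hZ, hS⟩, hfMA⟩), hr2.trans ?_⟩
      have h1 := ((hrA.append_right (u :: U)).append_left M) m
      have h2 := ((hrZ.append_right U).append_left (M ++ A)) m
      have h3 : RedAt ConnectingOrBasicMove m ((M ++ A ++ Z) ++ U) ((M ++ A ++ Z) ++ S) :=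
        RedAt.append_left _ fun k hk =>
          (Stack.fits_append.2 ⟨_, hfMA, hfZ⟩ : Stack.Fits m _ j).unique hk ▸ hrS
      simp only [List.append_assoc, List.cons_append, List.nil_append] at h1 h2 h3 ⊢
      exact (h1.trans h2).trans h3

end Connecting

/-! ### Simple trees -/

namespace StripGraph
variable {m n : ℕ} {Γ : StripGraph m n}

theorem Waist.isSimpleTree {K : ℕ} (hK : Γ.Waist K) (v : Γ.Vertex) (hv : ∀ w, Γ.IsRoot K w → w = v)
    (hF : Γ.IsSimpleForest) : Γ.IsSimpleTree :=
  have : Nonempty Γ.Vertex := ⟨v⟩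
  .inr ⟨hK.connected fun _ _ h h' => (hv _ h).trans (hv _ h').symm, hF⟩

/-- The only root is the strand between the merges and the splits. -/
theorem isSimpleTree_of_merges_splits {M S : Stack} (h : Γ.stack = M ++ S)
    (hM : M.All (· = merge)) (hS : S.All (· = split)) (hf : Stack.Fits m M 1) :
    Γ.IsSimpleTree := by
  have hK : Γ.Waist M.length := waist_of_append h (fun l hl => .inr (.inl (hM l hl)))
    (fun l hl => .inr (.inl (hS l hl)))
  have hw : Γ.stack.width m M.length = 1 := by
    have := Stack.width_length hf
    simpa [Stack.width, h] using this
  have hpiece : ∀ k : Fin Γ.stack.length,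
      (Γ.stack.get k).piece = merge ∨ (Γ.stack.get k).piece = split := by
    intro k
    have hmem : Γ.stack.get k ∈ M ++ S := h ▸ List.get_mem _ _
    exact (List.mem_append.1 hmem).imp (hM _) (hS _)
  refine hK.isSimpleTree (.inl ⟨⟨M.length, Nat.lt_succ_of_le hK.1⟩, ⟨0, by simp only; omega⟩⟩) ?_ ?_
  · rintro (⟨p, i⟩ | k) hr
    · obtain rfl : p = ⟨M.length, Nat.lt_succ_of_le hK.1⟩ := Fin.ext hr
      have hi : (i : ℕ) < Γ.stack.width m M.length := i.2
      have : i = ⟨0, by simp only; omega⟩ := Fin.ext (by simp only; omega)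
      rw [this]
    · exfalso
      rcases hpiece k with h1 | h1 <;> rcases hr with ⟨-, h2⟩ | ⟨-, h2⟩ <;> rw [h1] at h2 <;>
        simp [dom, cod] at h2
  · exact isSimpleForest_of_stack (E := []) (T := []) (by simpa using h) .nil
      (fun l hl => .inl (hM l hl)) (fun l hl => .inl (hS l hl)) .nil

/-- Without upper boundary, the only root is the last piece. -/
theorem isSimpleTree_of_merges_last {M : Stack} {l : Layer} (hn : n = 0)
    (h : Γ.stack = M ++ [l]) (hM : M.All (· = merge)) (hl : IsLower l.piece)
    (hF : Γ.IsSimpleForest) : Γ.IsSimpleTree := by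
  have hlen : Γ.stack.length = M.length + 1 := by simp [h]
  have hK : Γ.Waist (M ++ [l]).length := waist_of_append (B := []) (by simpa using h)
    (Stack.all_append.2 ⟨fun l hl => .inr (.inl (hM l hl)), Stack.all_cons.2 ⟨hl, .nil⟩⟩) .nil
  rw [List.length_append, List.length_singleton] at hK
  refine hK.isSimpleTree (.inr ⟨M.length, by omega⟩) ?_ hF
  rintro (⟨p, i⟩ | k) hr
  · exfalso
    have hi : 0 < Γ.stack.width m p := i.pos
    rw [show (p : ℕ) = Γ.stack.length from hr.trans hlen.symm, Stack.width_length Γ.fits] at hi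
    omega
  · congr 1
    refine Fin.ext ?_
    by_contra hk
    have hk' : (k : ℕ) < M.length := by
      have := k.2
      dsimp only at hk
      omega
    have hp : (Γ.stack.get k).piece = merge := by
      have : Γ.stack.get k = M[(k : ℕ)] := by
        simp only [List.get_eq_getElem, h]; exact List.getElem_append_left hk'
      rw [this]; exact hM _ (List.getElem_mem _)
    rcases hr with ⟨-, h2⟩ | ⟨h2, -⟩
    · rw [hp] at h2; simp [cod] at h2
    · omega

/-- Without lower boundary, the only root is the first piece. -/
theorem isSimpleTree_of_first_splits {S : Stack} {l : Layer} (hm : m = 0)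
    (h : Γ.stack = l :: S) (hS : S.All (· = split)) (hl : IsUpper l.piece)
    (hF : Γ.IsSimpleForest) : Γ.IsSimpleTree := by
  have hlen : Γ.stack.length = S.length + 1 := by simp [h]
  have hK : Γ.Waist ([] : Stack).length := waist_of_append (A := []) (B := l :: S) h .nil
    (Stack.all_cons.2 ⟨hl, fun l hl => .inr (.inl (hS l hl))⟩)
  refine hK.isSimpleTree (.inr ⟨0, by omega⟩) ?_ hF
  rintro (⟨p, i⟩ | k) hr
  · exfalso
    have hi : 0 < Γ.stack.width m p := i.pos
    rw [show (p : ℕ) = 0 from hr, Stack.width_zero] at hi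
    omega
  · congr 1
    refine Fin.ext ?_
    by_contra hk
    obtain ⟨j, hj⟩ : ∃ j, (k : ℕ) = j + 1 := Nat.exists_eq_succ_of_ne_zero hk
    have hp : (Γ.stack.get k).piece = split := by
      have hj' : j < S.length := by have := k.2; omega
      have : Γ.stack.get k = S[j] := by
        simp [List.get_eq_getElem, h, hj]
      rw [this]; exact hS _ (List.getElem_mem _)
    rcases hr with ⟨h2, -⟩ | ⟨-, h2⟩
    · simp at h2
    · rw [hp] at h2; simp [dom] at h2

theorem isSimpleTree_of_treeStack (h : TreeStack m n Γ.stack) : Γ.IsSimpleTree := by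
  rcases h with ⟨h0, h⟩ | ⟨M, S, h, hM, hS, hf⟩ | ⟨hn, h | ⟨M, h, hM⟩⟩ | ⟨hm, h | ⟨S, h, hS⟩⟩
  · left
    refine ⟨h0, ⟨?_⟩⟩
    rintro (⟨p, i⟩ | k)
    · have hi : 0 < Γ.stack.width m p := i.pos
      have hlen : Γ.stack.length = 0 := by rw [h]; rfl
      rw [show (p : ℕ) = 0 by omega, Stack.width_zero] at hi
      omega
    · have := k.2
      simp [h] at this
  · exact isSimpleTree_of_merges_splits h hM hS hf
  · exact isSimpleTree_of_merges_last (M := []) hn h .nil (.inl rfl)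
      (isSimpleForest_of_stack (E := [⟨0, endDot⟩]) (M := []) (W := []) (T := []) h
        (by simp [Stack.All]) .nil .nil .nil)
  · exact isSimpleTree_of_merges_last hn h hM (.inr (.inr rfl))
      (isSimpleForest_of_stack (E := []) (M := M ++ [⟨0, cap⟩]) (W := []) (T := [])
        (by simpa using h) .nil
        (Stack.all_append.2 ⟨fun l hl => .inl (hM l hl), by simp [Stack.All]⟩) .nil .nil)
  · exact isSimpleTree_of_first_splits (S := []) hm h .nil (.inl rfl)
      (isSimpleForest_of_stack (E := []) (M := []) (W := []) (T := [⟨0, startDot⟩]) h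
        .nil .nil .nil (by simp [Stack.All]))
  · exact isSimpleTree_of_first_splits hm h hS (.inr (.inr rfl))
      (isSimpleForest_of_stack (E := []) (M := []) (W := ⟨0, cup⟩ :: S) (T := [])
        (by simpa using h) .nil .nil (Stack.all_cons.2 ⟨.inr rfl, fun l hl => .inl (hS l hl)⟩) .nil)

end StripGraph

end OneColor

theorem mainTheorem7 (m n : ℕ) (Γ : OneColor.StripGraph m n) :
    (∃ F : OneColor.StripGraph m n,
      OneColor.Reduces OneColor.BasicMove Γ F ∧ F.IsSimpleForest) ∧
    (∀ F : OneColor.StripGraph m n,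
      OneColor.Reduces OneColor.BasicMove Γ F → F.IsSimpleForest →
        ∃ e : F.Component ≃ {C : Γ.Component // ∃ x, Γ.componentAt x = C},
          ∀ x : Fin m ⊕ Fin n, (e (F.componentAt x) : Γ.Component) = Γ.componentAt x) ∧
    (∃ T : OneColor.StripGraph m n,
      OneColor.Reduces OneColor.ConnectingOrBasicMove Γ T ∧ T.IsSimpleTree) := by
  refine ⟨?_, fun F hr hF => hr.exists_component_equiv hF, ?_⟩
  · obtain ⟨E, M, W, T, hE, hM, hW, hT, hr⟩ := OneColor.exists_red_forest Γ.stack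
    obtain ⟨hf, hr⟩ := hr m n Γ.fits
    exact ⟨_, hr, OneColor.StripGraph.isSimpleForest_of_stack rfl hE hM hW hT⟩
  · obtain ⟨t, ht, hr⟩ := OneColor.exists_redAt_treeStack Γ.stack Γ.fits
    obtain ⟨hf, hr⟩ := hr n Γ.fits
    exact ⟨_, hr, OneColor.StripGraph.isSimpleTree_of_treeStack ht⟩
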